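/- Let $P$ be a simple $3$-dimensional convex polytope (each vertex lies in exactly three facets) with $2n$ vertices, whose facets are coloured with the colours $1,2,3$ so that any two distinct facets sharing an edge have different colours. Let $V(P)$ be the vertex set of $P$; for a facet $f$ of $P$ let $\xi_f\in\{0,1\}^{V(P)}\subseteq\mathbb R^{2n}$ be its incidence vector ($\xi_f(v)=1$ if $v\in f$ and $\xi_f(v)=0$ otherwise), and let $\widetilde P=\operatorname{conv}\{\xi_f : f \text{ a facet of } P\}$. For $i=1,2,3$ let $m_i$ be the number of facets of colour $i$ and $V_i=\{\xi_f : f \text{ has colour } i\}$. A Gale transform of points $v_1,\dots,v_N$ whose convex hull has dimension $d$ consists of the $N$ rows of a matrix whose columns form a basis of the null space of $\begin{bmatrix}1&\cdots&1\\ v_1&\cdots&v_N\end{bmatrix}$; normalizing its nonzero members to unit length gives a Gale diagram in $\mathbb R^{N-d-1}$. The Gale diagram of a polytope is that of its vertices. The empty set is counted as a proper face. Suppose $m_3>m_2>m_1\ge 2$. Then the Gale diagram of $\widetilde P$ lies in $\mathbb R^1$, is unique up to the reflection $x\mapsto -x$, and (for one of the two choices of sign) consists of $m_2$ points at $1$,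 corresponding to the vertices in $V_2$, and $m_1+m_3$ points at $-1$, corresponding to the vertices in $V_1\cup V_3$. Moreover: (1) for a set $W$ of vertices of $\widetilde P$, $\operatorname{conv} W$ is a proper face of $\widetilde P$ if and only if $V_2\not\subseteq W$ and $V_1\cup V_3\not\subseteq W$; (2) $\widetilde P$ is a simplicial convex polytope, i.e. all its nonempty proper faces are simplices; (3) $\widetilde P$ is combinatorially equivalent (isomorphic face lattices) to $T^n_{m_2-1}=\operatorname{conv}(\{v\}\cup\Delta^n)$, where $\Delta^n\subseteq\mathbb R^n$ is an $n$-simplex and $v\in\mathbb R^n\setminus\Delta^n$ is a point beyond exactly $m_2-1$ facets of $\Delta^n$ and beneath all the others; such $\Delta^n$ and $v$ exist, and the equivalence holds for every choice of them. Here $v$ is beyond (beneath) a facet if it lies strictly on the opposite side (the same side) of the hyperplane spanned by the facet as the interior of $\Delta^n$. -/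

import Mathlib

/-! Convex polytopes, their faces, Gale diagrams, and the convex hull of the face-vertex incidence
vectors of a 3-face-coloured simple 3-polytope. -/

noncomputable section

namespace HullOfFaces

section Polytopes

variable {E : Type*} [AddCommGroup E] [Module ℝ E]

/-- A convex polytope: the convex hull of a finite set of points. -/
def IsPolytope (K : Set E) : Prop :=
  ∃ s : Set E, s.Finite ∧ K = convexHull ℝ s

/-- The affine dimension of a (nonempty) set. -/
def affDim (K : Set E) : ℕ := Module.finrank ℝ (vectorSpan ℝ K)

/-- A `k`-simplex: the convex hull of `k + 1` affinely independent points. -/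
def IsSimplex (k : ℕ) (K : Set E) : Prop :=
  ∃ p : Fin (k + 1) → E, AffineIndependent ℝ p ∧ K = convexHull ℝ (Set.range p)

variable [TopologicalSpace E]

/-- Faces of a polytope: `∅` and the sets of points where a linear functional attains its maximum
(the functional `0` gives the polytope itself). -/
def IsFace (K F : Set E) : Prop := IsExposed ℝ K F

/-- A proper face: a face different from the polytope (the empty face is allowed). -/
def IsProperFace (K F : Set E) : Prop := IsFace K F ∧ F ≠ K

/-- A facet: a nonempty face of codimension one. -/
def IsFacet (K F : Set E) : Prop :=
  IsFace K F ∧ F.Nonempty ∧ affDim F + 1 = affDim K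

/-- A simplicial polytope: all (nonempty) proper faces are simplices. -/
def IsSimplicialPolytope (K : Set E) : Prop :=
  IsPolytope K ∧ ∀ F : Set E, IsProperFace K F → F.Nonempty → ∃ k : ℕ, IsSimplex k F

/-- For a facet `F` of a full-dimensional polytope `K`: the point `v` and the interior of `K` lie
strictly on different sides of the hyperplane spanned by `F`. -/
def IsBeyond (K F : Set E) (v : E) : Prop :=
  ∃ (l : StrongDual ℝ E) (c : ℝ), (∀ x ∈ K, l x ≤ c) ∧ F = {x ∈ K | l x = c} ∧ c < l v

/-- For a facet `F` of a full-dimensional polytope `K`: the point `v` and the interior of `K` lie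
strictly on the same side of the hyperplane spanned by `F`. -/
def IsBeneath (K F : Set E) (v : E) : Prop :=
  ∃ (l : StrongDual ℝ E) (c : ℝ), (∀ x ∈ K, l x ≤ c) ∧ F = {x ∈ K | l x = c} ∧ l v < c

/-- Combinatorial equivalence: the face lattices are isomorphic. -/
def CombEquiv {E' : Type*} [AddCommGroup E'] [Module ℝ E'] [TopologicalSpace E']
    (K : Set E) (L : Set E') : Prop :=
  Nonempty ({F : Set E // IsFace K F} ≃o {G : Set E' // IsFace L G})

end Polytopes

/-- `K` is a polytope `T_k^n`: the convex hull in `ℝⁿ` of an `n`-simplex `Δ` and a point `v ∉ Δ`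
which is beyond exactly `k` facets of `Δ` and beneath all the other facets of `Δ`. -/
def IsT (n k : ℕ) (K : Set (EuclideanSpace ℝ (Fin n))) : Prop :=
  ∃ (Δ : Set (EuclideanSpace ℝ (Fin n))) (v : EuclideanSpace ℝ (Fin n)),
    IsSimplex n Δ ∧ v ∉ Δ ∧
    {F | IsFacet Δ F ∧ IsBeyond Δ F v}.ncard = k ∧
    (∀ F, IsFacet Δ F → ¬ IsBeyond Δ F v → IsBeneath Δ F v) ∧
    K = convexHull ℝ (insert v Δ)

section Gale

variable {ι E : Type*} [AddCommGroup E] [Module ℝ E]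

/-- The null space of the matrix with columns `(1, v i)`: the affine dependences of the `v i`. -/
def affineDependences (v : ι → E) : Submodule ℝ (ι →₀ ℝ) :=
  LinearMap.ker (Finsupp.linearCombination ℝ fun i => ((1 : ℝ), v i))

/-- `g` is a Gale transform of the finite family `v`: the `g i` are the rows of a matrix whose
columns form a basis of the space of affine dependences. For `N` points whose convex hull has
dimension `d`, such a `g` exists only for `k = N - d - 1`. -/
def IsGaleTransform (v : ι → E) {k : ℕ} (g : ι → EuclideanSpace ℝ (Fin k)) : Prop :=
  ∃ β : Module.Basis (Fin k) ℝ (affineDependences v),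
    ∀ i j, g i j = (β j : ι →₀ ℝ) i

/-- `D` is a Gale diagram of the polytope `K`: a Gale transform of the family of vertices of `K`
whose nonzero members are normalized onto the unit sphere. -/
def IsGaleDiagram (K : Set E) {k : ℕ}
    (D : (Set.extremePoints ℝ K) → EuclideanSpace ℝ (Fin k)) : Prop :=
  ∃ g : (Set.extremePoints ℝ K) → EuclideanSpace ℝ (Fin k),
    IsGaleTransform (fun x : Set.extremePoints ℝ K => (x : E)) g ∧
    ∀ x, D x = ‖g x‖⁻¹ • g x

end Gale

section ColouredPolytope

/-- The Euclidean space `ℝ³`. -/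
abbrev Space : Type := EuclideanSpace ℝ (Fin 3)

/-- The vertex set of `P`. -/
abbrev Vert (P : Set Space) : Set Space := Set.extremePoints ℝ P

/-- The type of facets (two-dimensional faces) of a 3-polytope `P`. -/
abbrev Facet (P : Set Space) : Type := {F : Set Space // IsFacet P F}

/-- `P` is a simple 3-dimensional convex polytope: each vertex lies in exactly three facets. -/
def IsSimple3Polytope (P : Set Space) : Prop :=
  IsPolytope P ∧ affDim P = 3 ∧ ∀ v ∈ Vert P, {F | IsFacet P F ∧ v ∈ F}.ncard = 3

/-- A 3-face-colouring: distinct facets sharing an edge get different colours. The colours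
`0, 1, 2 : Fin 3` stand for the colours 1, 2, 3. -/
def IsFaceColouring (P : Set Space) (col : Facet P → Fin 3) : Prop :=
  ∀ F G : Facet P, F ≠ G → affDim (F.1 ∩ G.1) = 1 → col F ≠ col G

/-- The face-vertex incidence vector of `F`, in `ℝ^V(P)`. -/
def incidence (P F : Set Space) : Vert P → ℝ :=
  Set.indicator {v : Vert P | (v : Space) ∈ F} 1

/-- The convex hull of the incidence vectors of all facets of `P`. -/
def incidenceHull (P : Set Space) : Set (Vert P → ℝ) :=
  convexHull ℝ (Set.range fun F : Facet P => incidence P F.1)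

/-- The set of incidence vectors of the facets of colour `i`. -/
def colourClass (P : Set Space) (col : Facet P → Fin 3) (i : Fin 3) : Set (Vert P → ℝ) :=
  {x | ∃ F : Facet P, col F = i ∧ x = incidence P F.1}

/-- The number of facets of colour `i`. -/
def colourCount (P : Set Space) (col : Facet P → Fin 3) (i : Fin 3) : ℕ :=
  {F : Facet P | col F = i}.ncard

end ColouredPolytope

end HullOfFaces

end

open HullOfFaces

/-! Everything follows from the affine dependences between the incidence vectors. Each vertex of `P`
lies in exactly one facet of each colour, so `∑ b_F ξ_F = 0` says that at every vertex the three
coefficients of its facets sum to zero. Adjacent vertices share two of their facets, hence the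
coefficients of the remaining two facets agree as well; since the graph of `P` is connected, `b_F`
depends only on the colour of `F`. What remains is `β₁ + β₂ + β₃ = 0` and `m₁β₁ + m₂β₂ + m₃β₃ = 0`,
solved by the multiples of `(m₂ - m₃, m₃ - m₁, m₁ - m₂)`, of signs `-, +, -`. So the incidence
vectors form an affine circuit (`IsVertexChart.isAffineCircuit`).

The signs of a circuit decide the rest. An index set spans a face iff it is everything or its
complement meets both signs (`IsAffineCircuit.faceOrderIso`), proper subfamilies are affinely
independent, and the one-dimensional Gale diagram records the signs
(`IsAffineCircuit.exists_isGaleDiagram`).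

A simplex together with a point off its facet hyperplanes is a circuit too, with barycentric
coordinates as coefficients; the positive ones belong to the point and to one vertex for each facet
it is beyond (`IsT.exists_isAffineCircuit`). Comparing the two circuits only needs the numbers of
positive and of all indices. The latter is `n + 2` by Euler's relation
(`IsVertexChart.two_mul_card_facet`), proved by counting the maxima and minima of a generic
functional on the facets.

The geometric input is that a full-dimensional polytope is cut out by its facets
(`IsPolytope.exists_isFacetSystem`), which yields linear coordinates at each simple vertex
(`exists_isVertexChart`). -/

namespace HullOfFaces

/-! ### Faces of convex hulls of finite families -/

section Faces

variable {E : Type*} [AddCommGroup E] [Module ℝ E]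

/-- The points strictly below level `c`, together with the hull of the generators at level `c`, form
a convex set containing `s`, hence containing the whole hull. -/
theorem mem_convexHull_filter_of_eq {s : Set E} (l : E →ₗ[ℝ] ℝ) {c : ℝ} (h : ∀ y ∈ s, l y ≤ c)
    {x : E} (hx : x ∈ convexHull ℝ s) (hxc : l x = c) : x ∈ convexHull ℝ {y ∈ s | l y = c} := by
  have hC : ∀ y ∈ convexHull ℝ {y ∈ s | l y = c}, l y = c := by
    intro y hy
    exact convexHull_min (fun z hz => hz.2) (convex_hyperplane l.isLinear c) hy
  have hconv : Convex ℝ {y | l y < c ∨ y ∈ convexHull ℝ {y ∈ s | l y = c}} := by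
    have hle : ∀ y, (l y < c ∨ y ∈ convexHull ℝ {y ∈ s | l y = c}) → l y ≤ c := by
      rintro y (hy | hy)
      · exact hy.le
      · exact (hC y hy).le
    intro y hy z hz a b ha hb hab
    rcases hy with hy' | hy'
    · rcases ha.eq_or_lt with rfl | ha
      · obtain rfl : b = 1 := by linarith
        simpa using hz
      · left
        have h1 := mul_lt_mul_of_pos_left hy' ha
        have h2 := mul_le_mul_of_nonneg_left (hle z hz) hb
        simp only [map_add, map_smul, smul_eq_mul]
        calc _ < a * c + b * c := by linarith
          _ = c := by rw [← add_mul, hab, one_mul]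
    · rcases hz with hz' | hz'
      · rcases hb.eq_or_lt with rfl | hb
        · obtain rfl : a = 1 := by linarith
          simpa using Or.inr hy'
        · left
          have h1 := mul_le_mul_of_nonneg_left (hC y hy').le ha
          have h2 := mul_lt_mul_of_pos_left hz' hb
          simp only [map_add, map_smul, smul_eq_mul]
          calc _ < a * c + b * c := by linarith
            _ = c := by rw [← add_mul, hab, one_mul]
      · right
        exact convex_convexHull ℝ _ hy' hz' ha hb hab
  have hsub : s ⊆ {y | l y < c ∨ y ∈ convexHull ℝ {y ∈ s | l y = c}} := by
    intro y hy
    rcases (h y hy).lt_or_eq with h' | h'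
    · exact Or.inl h'
    · exact Or.inr (subset_convexHull ℝ _ ⟨hy, h'⟩)
  rcases convexHull_min hsub hconv hx with h' | h'
  · exact absurd hxc h'.ne
  · exact h'

theorem le_of_mem_convexHull {s : Set E} (l : E →ₗ[ℝ] ℝ) {c : ℝ} (h : ∀ y ∈ s, l y ≤ c)
    {x : E} (hx : x ∈ convexHull ℝ s) : l x ≤ c :=
  convexHull_min h (convex_halfSpace_le l.isLinear c) hx

theorem sep_convexHull_eq {s : Set E} (l : E →ₗ[ℝ] ℝ) {c : ℝ} (h : ∀ y ∈ s, l y ≤ c) :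
    {x ∈ convexHull ℝ s | l x = c} = convexHull ℝ {y ∈ s | l y = c} := by
  apply Set.Subset.antisymm
  · rintro x ⟨hx, hxc⟩
    exact mem_convexHull_filter_of_eq l h hx hxc
  · intro x hx
    exact ⟨convexHull_mono (fun y hy => hy.1) hx,
      convexHull_min (fun z hz => hz.2) (convex_hyperplane l.isLinear c) hx⟩

variable [TopologicalSpace E]

/-- `IsExposed` asks for a functional only when the set is nonempty, so the bound `c` need not be
attained. -/
theorem isFace_sep {K : Set E} (l : StrongDual ℝ E) {c : ℝ} (h : ∀ x ∈ K, l x ≤ c) :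
    IsFace K {x ∈ K | l x = c} := by
  rintro ⟨y, hy, hyc⟩
  refine ⟨l, Set.ext fun x => ⟨?_, ?_⟩⟩
  · rintro ⟨hx, hxc⟩
    exact ⟨hx, fun z hz => (h z hz).trans hxc.ge⟩
  · rintro ⟨hx, hxc⟩
    exact ⟨hx, le_antisymm (h x hx) (hyc ▸ hxc y hy)⟩

theorem IsFace.exists_functional {K F : Set E} (h : IsFace K F) (hF : F.Nonempty) :
    ∃ (l : StrongDual ℝ E) (c : ℝ), (∀ x ∈ K, l x ≤ c) ∧ F = {x ∈ K | l x = c} := by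
  obtain ⟨l, hl⟩ := h hF
  obtain ⟨y, hy⟩ := hF
  have hy' := hy
  rw [hl] at hy'
  refine ⟨l, l y, hy'.2, Set.ext fun x => ⟨fun hx => ?_, ?_⟩⟩
  · rw [hl] at hx
    exact ⟨hx.1, le_antisymm (hy'.2 x hx.1) (hx.2 y hy'.1)⟩
  · rintro ⟨hx, hxc⟩
    rw [hl]
    exact ⟨hx, fun z hz => hxc ▸ hy'.2 z hz⟩

theorem isFace_self (K : Set E) : IsFace K K := by
  have := isFace_sep (K := K) (0 : StrongDual ℝ E) (c := 0) (by simp)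
  simpa using this

theorem IsFace.eq_convexHull_inter {s F : Set E} (h : IsFace (convexHull ℝ s) F) :
    F = convexHull ℝ (s ∩ F) := by
  rcases F.eq_empty_or_nonempty with rfl | hF
  · simp
  · obtain ⟨l, c, hl, rfl⟩ := h.exists_functional hF
    have hs : ∀ y ∈ s, (l : E →ₗ[ℝ] ℝ) y ≤ c := fun y hy => hl y (subset_convexHull ℝ s hy)
    have := sep_convexHull_eq (l : E →ₗ[ℝ] ℝ) hs
    refine this.trans ?_
    congr 1
    ext y
    constructor
    · rintro ⟨hy, hyc⟩
      exact ⟨hy, subset_convexHull ℝ s hy, hyc⟩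
    · rintro ⟨hy, -, hyc⟩
      exact ⟨hy, hyc⟩

theorem IsFace.eq_convexHull_image {ι : Type*} {v : ι → E} {F : Set E}
    (h : IsFace (convexHull ℝ (Set.range v)) F) : F = convexHull ℝ (v '' {i | v i ∈ F}) := by
  conv_lhs => rw [h.eq_convexHull_inter]
  congr 1
  ext y
  constructor
  · rintro ⟨⟨i, rfl⟩, hy⟩
    exact ⟨i, hy, rfl⟩
  · rintro ⟨i, hi, rfl⟩
    exact ⟨⟨i, rfl⟩, hi⟩

variable [IsTopologicalAddGroup E] [ContinuousSMul ℝ E] [T2Space E] [FiniteDimensional ℝ E]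
  {ι : Type*} [Fintype ι]

/-- Pairing with `h` kills the kernel of `b ↦ ∑ b i • (1, v i)`, so it factors through this map. The
factor is a functional on `ℝ × E`, whose two components give `c` and `l`. -/
theorem exists_functional_of_dependences (v : ι → E) (h : ι → ℝ)
    (hh : ∀ b : ι → ℝ, ∑ i, b i = 0 → ∑ i, b i • v i = 0 → ∑ i, b i * h i = 0) :
    ∃ (l : StrongDual ℝ E) (c : ℝ), ∀ i, l (v i) = h i + c := by
  classical
  let T : (ι → ℝ) →ₗ[ℝ] ℝ × E := Fintype.linearCombination ℝ fun i => ((1 : ℝ), v i)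
  let H : (ι → ℝ) →ₗ[ℝ] ℝ := Fintype.linearCombination ℝ h
  have hT : ∀ b, T b = (∑ i, b i, ∑ i, b i • v i) := by
    intro b
    simp [T, Fintype.linearCombination_apply, Prod.ext_iff, Prod.fst_sum, Prod.snd_sum]
  have hH : H ∈ T.ker.dualAnnihilator := by
    rw [Submodule.mem_dualAnnihilator]
    intro b hb
    rw [LinearMap.mem_ker, hT] at hb
    have := hh b (congrArg Prod.fst hb) (congrArg Prod.snd hb)
    simpa [H, Fintype.linearCombination_apply] using this
  rw [← LinearMap.range_dualMap_eq_dualAnnihilator_ker] at hH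
  obtain ⟨φ, hφ⟩ := hH
  have hφi : ∀ i, φ (1, v i) = h i := by
    intro i
    have := LinearMap.congr_fun hφ (Pi.single i 1)
    simpa [T, H, Fintype.linearCombination_apply, Pi.single_apply] using this
  refine ⟨LinearMap.toContinuousLinearMap (φ ∘ₗ LinearMap.inr ℝ ℝ E), -φ (1, 0), fun i => ?_⟩
  have : φ (1, v i) = φ (1, 0) + φ (0, v i) := by rw [← map_add]; simp
  rw [← hφi i, this]
  simp

/-- Nonnegative heights annihilated by all affine dependences expose the face on which they
vanish. -/
theorem isFace_of_heights {v : ι → E} {h : ι → ℝ}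
    (hh : ∀ b : ι → ℝ, ∑ i, b i = 0 → ∑ i, b i • v i = 0 → ∑ i, b i * h i = 0)
    (h0 : ∀ i, 0 ≤ h i) :
    IsFace (convexHull ℝ (Set.range v)) (convexHull ℝ (v '' {i | h i = 0})) ∧
      ∀ i, v i ∈ convexHull ℝ (v '' {i | h i = 0}) ↔ h i = 0 := by
  -- Faces are sets of maxima, so the nonnegative heights enter with a minus sign.
  obtain ⟨l, c, hl⟩ := exists_functional_of_dependences v (fun i => -h i) (by
    intro b hb hb'
    simpa using hh b hb hb')
  have hs : ∀ y ∈ Set.range v, (l : E →ₗ[ℝ] ℝ) y ≤ c := by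
    rintro _ ⟨i, rfl⟩
    have := h0 i
    change l (v i) ≤ c
    rw [hl]
    linarith
  have heq := sep_convexHull_eq (l : E →ₗ[ℝ] ℝ) hs
  have himg : {y ∈ Set.range v | (l : E →ₗ[ℝ] ℝ) y = c} = v '' {i | h i = 0} := by
    ext y
    constructor
    · rintro ⟨⟨i, rfl⟩, hy⟩
      refine ⟨i, ?_, rfl⟩
      have hy : l (v i) = c := hy
      rw [hl] at hy
      change h i = 0
      linarith
    · rintro ⟨i, hi, rfl⟩
      have hi : h i = 0 := hi
      refine ⟨⟨i, rfl⟩, ?_⟩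
      change l (v i) = c
      rw [hl, hi]
      simp
  rw [himg] at heq
  constructor
  · rw [← heq]
    exact isFace_sep l (fun x hx => le_of_mem_convexHull (l : E →ₗ[ℝ] ℝ) hs hx)
  · intro i
    rw [← heq]
    constructor
    · rintro ⟨-, hi⟩
      have hi : l (v i) = c := hi
      rw [hl] at hi
      linarith
    · intro hi
      refine ⟨subset_convexHull ℝ _ ⟨i, rfl⟩, ?_⟩
      change l (v i) = c
      rw [hl, hi]
      simp

end Faces

/-! ### Affine circuits and their face lattices -/

section Circuits

/-- The affine dependences of the family `v` are the multiples of `a`, which vanishes nowhere. -/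
structure IsAffineCircuit {ι E : Type*} [Fintype ι] [AddCommGroup E] [Module ℝ E]
    (v : ι → E) (a : ι → ℝ) : Prop where
  sum_eq_zero : ∑ i, a i = 0
  sum_smul_eq_zero : ∑ i, a i • v i = 0
  exists_smul : ∀ b : ι → ℝ, ∑ i, b i = 0 → ∑ i, b i • v i = 0 → ∃ t : ℝ, ∀ i, b i = t * a i
  ne_zero : ∀ i, a i ≠ 0

/-- The index sets of the faces of the convex hull of an affine circuit with coefficients `a`. -/
def IsCofacial {ι : Type*} (a : ι → ℝ) (S : Set ι) : Prop :=
  S = Set.univ ∨ (∃ i, i ∉ S ∧ 0 < a i) ∧ ∃ i, i ∉ S ∧ a i < 0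

theorem isCofacial_empty {ι : Type*} {a : ι → ℝ} (hp : ∃ i, 0 < a i)
    (hn : ∃ i, a i < 0) : IsCofacial a ∅ :=
  Or.inr ⟨by simpa using hp, by simpa using hn⟩

theorem isCofacial_image_iff {ι κ : Type*} {a : ι → ℝ} {a' : κ → ℝ} (e : ι ≃ κ)
    (hp : ∀ i, 0 < a i ↔ 0 < a' (e i)) (hn : ∀ i, a i < 0 ↔ a' (e i) < 0) (S : Set ι) :
    IsCofacial a S ↔ IsCofacial a' (e '' S) := by
  have hmem : ∀ i, e i ∈ e '' S ↔ i ∈ S := fun i => e.injective.mem_set_image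
  have huniv : S = Set.univ ↔ e '' S = Set.univ := by
    constructor
    · rintro rfl
      simp
    · intro h
      ext i
      simp [← hmem, h]
  simp only [IsCofacial, huniv, e.symm.exists_congr_left, hmem, hp, hn,
    Equiv.symm_symm]

/-- The hypotheses amount to having at least two coefficients of each sign; this is what makes every
point of the circuit a vertex. -/
theorem isCofacial_singleton {ι : Type*} {a : ι → ℝ} (hp : ∀ j, ∃ i, i ≠ j ∧ 0 < a i)
    (hn : ∀ j, ∃ i, i ≠ j ∧ a i < 0) (j : ι) : IsCofacial a {j} :=
  Or.inr ⟨by simpa using hp j, by simpa using hn j⟩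

variable {ι E : Type*} [Fintype ι] [AddCommGroup E] [Module ℝ E] {v : ι → E} {a : ι → ℝ}

/-- Outside `S`, give every positive index the total negative mass and every negative index the
total positive mass: the two contributions to `∑ a i * h i` cancel. -/
theorem exists_heights {S : Set ι} (hp : ∃ i, i ∉ S ∧ 0 < a i) (hn : ∃ i, i ∉ S ∧ a i < 0)
    (hne : ∀ i, a i ≠ 0) :
    ∃ h : ι → ℝ, (∀ i, 0 ≤ h i) ∧ (∀ i, h i = 0 ↔ i ∈ S) ∧ ∑ i, a i * h i = 0 := by
  classical
  obtain ⟨i, hiS, hi⟩ := hp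
  obtain ⟨j, hjS, hj⟩ := hn
  let f : ι → ℝ := fun k => if k ∈ S then 0 else max (a k) 0
  let g : ι → ℝ := fun k => if k ∈ S then 0 else max (-a k) 0
  have hf : 0 < ∑ k, f k := by
    refine Finset.sum_pos' (fun k _ => ?_) ⟨i, Finset.mem_univ _, ?_⟩
    · simp only [f]; split_ifs <;> simp
    · simp [f, hiS, hi]
  have hg : 0 < ∑ k, g k := by
    refine Finset.sum_pos' (fun k _ => ?_) ⟨j, Finset.mem_univ _, ?_⟩
    · simp only [g]; split_ifs <;> simp
    · simp [g, hjS, hj]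
  refine ⟨fun k => if k ∈ S then 0 else if 0 < a k then ∑ k, g k else ∑ k, f k,
    fun k => ?_, fun k => ?_, ?_⟩
  · dsimp only
    split_ifs <;> first | exact le_rfl | exact hf.le | exact hg.le
  · dsimp only
    split_ifs with h1 h2
    · simp [h1]
    · simp [h1, hg.ne']
    · simp [h1, hf.ne']
  · have : ∀ k, a k * (if k ∈ S then 0 else if 0 < a k then ∑ k, g k else ∑ k, f k)
        = f k * ∑ k, g k - g k * ∑ k, f k := by
      intro k
      by_cases hk : k ∈ S
      · simp [f, g, hk]
      · rcases lt_or_gt_of_ne (hne k) with h | h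
        · have h' : ¬ 0 < a k := h.le.not_gt
          simp only [hk, h', if_false]
          simp only [show f k = 0 by simp [f, hk, h.le], show g k = -a k by simp [g, hk, h.le]]
          ring
        · simp only [hk, h, if_false, if_true]
          simp only [show f k = a k by simp [f, hk, h.le], show g k = 0 by simp [g, hk, h.le]]
          ring
    simp_rw [this]
    rw [Finset.sum_sub_distrib, ← Finset.sum_mul, ← Finset.sum_mul]
    ring

/-- If the complement of `S` missed a sign, all terms `a i * h i` would have the same sign and sum
to zero, so each would vanish, forcing `h = 0` and `S` to be everything. -/
theorem eq_univ_or_of_heights {S : Set ι} {h : ι → ℝ} (h0 : ∀ i, 0 ≤ h i)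
    (hS : ∀ i, h i = 0 ↔ i ∈ S) (hsum : ∑ i, a i * h i = 0) (hne : ∀ i, a i ≠ 0) :
    IsCofacial a S := by
  by_contra hcon
  simp only [IsCofacial, not_or, not_and_or, not_exists, not_lt] at hcon
  obtain ⟨hu, hcon⟩ := hcon
  apply hu
  have hz : ∀ i, a i * h i = 0 := by
    rcases hcon with hcon | hcon
    · have : ∀ i ∈ Finset.univ, a i * h i ≤ 0 := by
        intro i _
        rcases hcon i with hi | hi
        · rw [not_not, ← hS] at hi
          simp [hi]
        · exact mul_nonpos_of_nonpos_of_nonneg hi (h0 i)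
      have := (Finset.sum_eq_zero_iff_of_nonpos this).1 hsum
      exact fun i => this i (Finset.mem_univ i)
    · have : ∀ i ∈ Finset.univ, 0 ≤ a i * h i := by
        intro i _
        rcases hcon i with hi | hi
        · rw [not_not, ← hS] at hi
          simp [hi]
        · exact mul_nonneg hi (h0 i)
      have := (Finset.sum_eq_zero_iff_of_nonneg this).1 hsum
      exact fun i => this i (Finset.mem_univ i)
  ext i
  simp only [Set.mem_univ, iff_true]
  rw [← hS]
  exact (mul_eq_zero.1 (hz i)).resolve_left (hne i)

theorem IsAffineCircuit.sum_mul_eq_zero (hv : IsAffineCircuit v a) {h : ι → ℝ}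
    (hsum : ∑ i, a i * h i = 0) (b : ι → ℝ) (hb : ∑ i, b i = 0) (hb' : ∑ i, b i • v i = 0) :
    ∑ i, b i * h i = 0 := by
  obtain ⟨t, ht⟩ := hv.exists_smul b hb hb'
  simp_rw [ht, mul_assoc]
  rw [← Finset.mul_sum, hsum, mul_zero]

/-- Proper subfamilies of an affine circuit are affinely independent. -/
theorem IsAffineCircuit.isSimplex (hv : IsAffineCircuit v a) {S : Set ι} (hS : S.Nonempty)
    (hS' : S ≠ Set.univ) : ∃ k, IsSimplex k (convexHull ℝ (v '' S)) := by
  classical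
  obtain ⟨i₀, hi₀⟩ := (Set.ne_univ_iff_exists_notMem S).1 hS'
  have hind : AffineIndependent ℝ (fun i : S => v i) := by
    rw [affineIndependent_iff]
    intro s w hw hw' i hi
    -- Extension of `w` by zero to all of `ι`. As a multiple of `a` that vanishes at `i₀ ∉ S`, it is
    -- zero.
    let b : ι → ℝ := fun j => ∑ e ∈ s, if (e : ι) = j then w e else 0
    have hb : ∑ j, b j = 0 := by
      simp only [b]
      rw [Finset.sum_comm]
      simpa using hw
    have hb' : ∑ j, b j • v j = 0 := by
      simp only [b, Finset.sum_smul, ite_smul, zero_smul]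
      rw [Finset.sum_comm]
      simpa using hw'
    obtain ⟨t, ht⟩ := hv.exists_smul b hb hb'
    have hbi₀ : b i₀ = 0 :=
      Finset.sum_eq_zero fun e _ => if_neg fun (h : (e : ι) = i₀) => hi₀ (h ▸ e.2)
    have ht0 : t = 0 := by
      have := ht i₀
      rw [hbi₀] at this
      exact (mul_eq_zero.1 this.symm).resolve_right (hv.ne_zero i₀)
    have hbi : b i = w i := by
      simp only [b]
      rw [Finset.sum_eq_single i]
      · simp
      · intro e _ he
        exact if_neg fun h => he (Subtype.ext h)
      · exact fun h => absurd hi h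
    rw [← hbi, ht, ht0, zero_mul]
  have hcard : Fintype.card S = (Fintype.card S - 1) + 1 := by
    have : 0 < Fintype.card S := Fintype.card_pos_iff.2 hS.to_subtype
    omega
  refine ⟨Fintype.card S - 1, fun k => v ((Fintype.equivFinOfCardEq hcard).symm k),
    hind.comp_embedding (Fintype.equivFinOfCardEq hcard).symm.toEmbedding, ?_⟩
  congr 1
  rw [show (fun k => v ((Fintype.equivFinOfCardEq hcard).symm k)) =
    (fun i : S => v i) ∘ (Fintype.equivFinOfCardEq hcard).symm from rfl,
    (Fintype.equivFinOfCardEq hcard).symm.surjective.range_comp]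
  ext y
  simp

theorem IsAffineCircuit.isSimplicialPolytope [TopologicalSpace E] (hv : IsAffineCircuit v a) :
    IsSimplicialPolytope (convexHull ℝ (Set.range v)) := by
  refine ⟨⟨_, Set.finite_range v, rfl⟩, fun F ⟨hF, hFne⟩ hne => ?_⟩
  rw [hF.eq_convexHull_image] at hne hFne ⊢
  refine hv.isSimplex ?_ ?_
  · simpa using hne
  · intro h
    rw [h, Set.image_univ] at hFne
    exact hFne rfl

/-- The depths `c - l (v i)` below a supporting hyperplane are nonnegative heights orthogonal to
`a`. -/
theorem IsAffineCircuit.isCofacial_of_isFace [TopologicalSpace E] (hv : IsAffineCircuit v a)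
    {F : Set E} (hF : IsFace (convexHull ℝ (Set.range v)) F) (hne : F.Nonempty) :
    IsCofacial a {i | v i ∈ F} := by
  obtain ⟨l, c, hl, rfl⟩ := hF.exists_functional hne
  have hm : ∀ i, v i ∈ convexHull ℝ (Set.range v) := fun i =>
    subset_convexHull ℝ _ (Set.mem_range_self i)
  refine eq_univ_or_of_heights (h := fun i => c - l (v i)) (fun i => ?_) (fun i => ?_) ?_
    hv.ne_zero
  · exact sub_nonneg.2 (hl _ (hm i))
  · simp only [Set.mem_ofPred_eq, hm i, true_and, sub_eq_zero]
    exact eq_comm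
  · have := congrArg l hv.sum_smul_eq_zero
    simp only [map_sum, map_smul, smul_eq_mul, map_zero] at this
    simp only [mul_sub, Finset.sum_sub_distrib, ← Finset.sum_mul, hv.sum_eq_zero, this]
    ring

theorem IsAffineCircuit.isCofacial [TopologicalSpace E] (hv : IsAffineCircuit v a)
    (hp : ∃ i, 0 < a i) (hn : ∃ i, a i < 0) {F : Set E} (hF : IsFace (convexHull ℝ (Set.range v)) F) :
    IsCofacial a {i | v i ∈ F} := by
  rcases F.eq_empty_or_nonempty with rfl | hne
  · simpa using isCofacial_empty hp hn
  · exact hv.isCofacial_of_isFace hF hne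

variable [TopologicalSpace E] [IsTopologicalAddGroup E] [ContinuousSMul ℝ E] [T2Space E]
  [FiniteDimensional ℝ E]

theorem IsAffineCircuit.isFace_convexHull_image (hv : IsAffineCircuit v a) {S : Set ι}
    (hS : IsCofacial a S) :
    IsFace (convexHull ℝ (Set.range v)) (convexHull ℝ (v '' S)) ∧
      ∀ i, v i ∈ convexHull ℝ (v '' S) ↔ i ∈ S := by
  rcases hS with rfl | ⟨hp, hn⟩
  · rw [Set.image_univ]
    exact ⟨isFace_self _, fun i => by simpa using subset_convexHull ℝ _ (Set.mem_range_self i)⟩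
  · obtain ⟨h, h0, hS, hsum⟩ := exists_heights hp hn hv.ne_zero
    have := isFace_of_heights (hv.sum_mul_eq_zero hsum) h0
    rw [show S = {i | h i = 0} from Set.ext fun i => (hS i).symm]
    exact this

/-- The face lattice of the convex hull of an affine circuit. -/
def IsAffineCircuit.faceOrderIso (hv : IsAffineCircuit v a) (hp : ∃ i, 0 < a i)
    (hn : ∃ i, a i < 0) :
    {F : Set E // IsFace (convexHull ℝ (Set.range v)) F} ≃o {S : Set ι // IsCofacial a S} where
  toFun F := ⟨{i | v i ∈ F.1}, hv.isCofacial hp hn F.2⟩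
  invFun S := ⟨convexHull ℝ (v '' S.1), (hv.isFace_convexHull_image S.2).1⟩
  left_inv F := Subtype.ext F.2.eq_convexHull_image.symm
  right_inv S := Subtype.ext (Set.ext (hv.isFace_convexHull_image S.2).2)
  map_rel_iff' {F G} := by
    constructor
    · intro h
      change F.1 ⊆ G.1
      rw [F.2.eq_convexHull_image, G.2.eq_convexHull_image]
      exact convexHull_mono (Set.image_mono h)
    · exact fun h i hi => h hi

theorem IsAffineCircuit.combEquiv {κ E' : Type*} [Fintype κ] [AddCommGroup E'] [Module ℝ E']
    [TopologicalSpace E'] [IsTopologicalAddGroup E'] [ContinuousSMul ℝ E'] [T2Space E']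
    [FiniteDimensional ℝ E'] {v' : κ → E'} {a' : κ → ℝ} (hv : IsAffineCircuit v a)
    (hv' : IsAffineCircuit v' a') (e : ι ≃ κ) (he : ∀ i, 0 < a i ↔ 0 < a' (e i))
    (hp : ∃ i, 0 < a i) (hn : ∃ i, a i < 0) :
    CombEquiv (convexHull ℝ (Set.range v)) (convexHull ℝ (Set.range v')) := by
  have he' : ∀ i, a i < 0 ↔ a' (e i) < 0 := by
    intro i
    have h1 := hv.ne_zero i
    have h2 := hv'.ne_zero (e i)
    rw [← not_iff_not, not_lt, not_lt, le_iff_lt_or_eq, le_iff_lt_or_eq, he]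
    simp [h1.symm, h2.symm]
  have hp' : ∃ i, 0 < a' i := hp.imp' e fun i hi => (he i).1 hi
  have hn' : ∃ i, a' i < 0 := hn.imp' e fun i hi => (he' i).1 hi
  let f : {S : Set ι // IsCofacial a S} ≃o {S : Set κ // IsCofacial a' S} :=
    { toEquiv := (Equiv.Set.congr e).subtypeEquiv fun S => isCofacial_image_iff e he he' S
      map_rel_iff' := fun {S T} => Set.image_subset_image_iff e.injective }
  exact ⟨(hv.faceOrderIso hp hn).trans (f.trans (hv'.faceOrderIso hp' hn').symm)⟩

/-- The set `{j}` is cofacial, so the face spanned by `v j` contains `v i` only for `i = j`. -/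
theorem IsAffineCircuit.injective (hv : IsAffineCircuit v a) (hp : ∀ j, ∃ i, i ≠ j ∧ 0 < a i)
    (hn : ∀ j, ∃ i, i ≠ j ∧ a i < 0) : Function.Injective v := by
  intro i j hij
  have := ((hv.isFace_convexHull_image (isCofacial_singleton hp hn j)).2 i).1 (by simp [hij])
  simpa using this

theorem IsAffineCircuit.extremePoints_eq (hv : IsAffineCircuit v a)
    (hp : ∀ j, ∃ i, i ≠ j ∧ 0 < a i) (hn : ∀ j, ∃ i, i ≠ j ∧ a i < 0) :
    Set.extremePoints ℝ (convexHull ℝ (Set.range v)) = Set.range v := by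
  apply Set.Subset.antisymm extremePoints_convexHull_subset
  rintro _ ⟨j, rfl⟩
  have hface := (hv.isFace_convexHull_image (isCofacial_singleton hp hn j)).1
  rw [Set.image_singleton, convexHull_singleton] at hface
  exact isExtreme_singleton.1 hface.isExtreme

theorem IsAffineCircuit.isProperFace_convexHull_image_iff (hv : IsAffineCircuit v a)
    (hp : ∀ j, ∃ i, i ≠ j ∧ 0 < a i) (hn : ∀ j, ∃ i, i ≠ j ∧ a i < 0) (S : Set ι) :
    IsProperFace (convexHull ℝ (Set.range v)) (convexHull ℝ (v '' S)) ↔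
      (∃ i, i ∉ S ∧ 0 < a i) ∧ ∃ i, i ∉ S ∧ a i < 0 := by
  -- Here `S` need not be cofacial; instead, `v i` is extreme in the whole hull, hence in the
  -- smaller one, and so is one of its generators.
  have hmem : ∀ i, v i ∈ convexHull ℝ (v '' S) ↔ i ∈ S := by
    intro i
    constructor
    · intro hi
      have hext : v i ∈ Set.extremePoints ℝ (convexHull ℝ (Set.range v)) := by
        rw [hv.extremePoints_eq hp hn]
        exact ⟨i, rfl⟩
      have := inter_extremePoints_subset_extremePoints_of_subset
        (convexHull_mono (Set.image_subset_range v S)) ⟨hi, hext⟩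
      obtain ⟨j, hj, hji⟩ := extremePoints_convexHull_subset this
      rwa [← hv.injective hp hn hji]
    · exact fun hi => subset_convexHull ℝ _ ⟨i, hi, rfl⟩
  constructor
  · rintro ⟨hF, hne⟩
    -- With no indices both hulls are empty, so the face would not be proper.
    have hex : ∃ j : ι, True := by
      by_contra hcon
      have : IsEmpty ι := ⟨fun j => hcon ⟨j, trivial⟩⟩
      apply hne
      rw [Set.eq_empty_of_isEmpty S, Set.range_eq_empty, Set.image_empty]
    obtain ⟨j, -⟩ := hex
    have := hv.isCofacial ((hp j).imp fun _ h => h.2) ((hn j).imp fun _ h => h.2) hF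
    simp only [hmem, Set.ofPred_mem_eq] at this
    rcases this with rfl | h
    · simp at hne
    · exact h
  · intro h
    refine ⟨(hv.isFace_convexHull_image (Or.inr h)).1, fun heq => ?_⟩
    obtain ⟨⟨i, hi, -⟩, -⟩ := h
    rw [← hmem, heq] at hi
    exact hi (subset_convexHull ℝ _ ⟨i, rfl⟩)

end Circuits
-- Gale diagrams of affine circuits
section GaleDiagram

theorem mem_affineDependences_iff {X E : Type*} [Fintype X] [AddCommGroup E] [Module ℝ E]
    (v : X → E) (b : X →₀ ℝ) :
    b ∈ affineDependences v ↔ ∑ x, b x = 0 ∧ ∑ x, b x • v x = 0 := by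
  rw [affineDependences, LinearMap.mem_ker, Finsupp.linearCombination_apply,
    Finsupp.sum_fintype _ _ (by simp), Prod.ext_iff]
  simp [Prod.fst_sum, Prod.snd_sum]

theorem inv_norm_smul_apply (g : EuclideanSpace ℝ (Fin 1)) (r s : ℝ) (hs : |s| = 1)
    (hr : 0 < r) (hg : g 0 = s * r) : ‖g‖⁻¹ • g = !₂[s] := by
  have hn : ‖g‖ = r := by
    rw [EuclideanSpace.norm_eq]
    simp only [Finset.univ_unique, Fin.default_eq_zero, Finset.sum_singleton, hg]
    rw [Real.norm_eq_abs, sq_abs, Real.sqrt_sq_eq_abs, abs_mul, hs, abs_of_pos hr, one_mul]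
  ext i
  fin_cases i
  simp [hn, hg]
  field_simp

variable {X E : Type*} [Fintype X] [AddCommGroup E] [Module ℝ E] {v : X → E} {a : X → ℝ}

/-- The coefficients of an affine circuit as an element of the space of affine dependences. -/
noncomputable def IsAffineCircuit.dependence (hv : IsAffineCircuit v a) : affineDependences v :=
  ⟨Finsupp.equivFunOnFinite.symm a, by
    rw [mem_affineDependences_iff]
    exact ⟨hv.sum_eq_zero, hv.sum_smul_eq_zero⟩⟩

theorem IsAffineCircuit.dependence_apply (hv : IsAffineCircuit v a) (x : X) :
    (hv.dependence : X →₀ ℝ) x = a x := rfl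

theorem IsAffineCircuit.exists_smul_dependence (hv : IsAffineCircuit v a)
    (b : affineDependences v) : ∃ t : ℝ, b = t • hv.dependence := by
  obtain ⟨h1, h2⟩ := (mem_affineDependences_iff v b.1).1 b.2
  obtain ⟨t, ht⟩ := hv.exists_smul b.1 h1 h2
  exact ⟨t, Subtype.ext (Finsupp.ext fun x => by simp [ht, hv.dependence_apply])⟩

theorem IsAffineCircuit.dependence_ne_zero [Nonempty X] (hv : IsAffineCircuit v a) :
    hv.dependence ≠ 0 := by
  intro h
  obtain ⟨x⟩ := ‹Nonempty X›
  have := hv.dependence_apply x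
  rw [h, ZeroMemClass.coe_zero, Finsupp.zero_apply] at this
  exact hv.ne_zero x this.symm

theorem isGaleTransform_of_basis {X E : Type*} [AddCommGroup E] [Module ℝ E] {v : X → E}
    {a : X → ℝ} (β : Module.Basis (Fin 1) ℝ (affineDependences v))
    (h : ∀ x, (β 0 : X →₀ ℝ) x = a x) :
    IsGaleTransform (k := 1) v fun x => WithLp.toLp 2 fun _ => a x :=
  ⟨β, fun x j => by rw [Subsingleton.elim j 0, h]⟩

theorem exists_basis_of_forall_exists_smul {V : Type*} [AddCommGroup V] [Module ℝ V] {u : V}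
    (hu : u ≠ 0) (h : ∀ b : V, ∃ t : ℝ, b = t • u) :
    ∃ β : Module.Basis (Fin 1) ℝ V, β 0 = u := by
  have hind : LinearIndependent ℝ (fun _ : Fin 1 => u) :=
    LinearIndependent.of_subsingleton (0 : Fin 1) hu
  have hspan : ⊤ ≤ Submodule.span ℝ (Set.range fun _ : Fin 1 => u) := by
    intro b _
    obtain ⟨t, rfl⟩ := h b
    exact Submodule.smul_mem _ _ (Submodule.subset_span ⟨0, rfl⟩)
  exact ⟨Module.Basis.mk hind hspan, Module.Basis.mk_apply hind hspan 0⟩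

theorem IsAffineCircuit.isGaleTransform [Nonempty X] (hv : IsAffineCircuit v a) :
    IsGaleTransform (k := 1) v fun x => WithLp.toLp 2 fun _ => a x := by
  obtain ⟨β, hβ⟩ := exists_basis_of_forall_exists_smul (V := affineDependences v)
    hv.dependence_ne_zero hv.exists_smul_dependence
  exact isGaleTransform_of_basis β fun x => by rw [hβ, hv.dependence_apply]

theorem IsAffineCircuit.exists_eq_of_isGaleTransform (hv : IsAffineCircuit v a)
    {g : X → EuclideanSpace ℝ (Fin 1)} (hg : IsGaleTransform v g) :
    ∃ t : ℝ, t ≠ 0 ∧ ∀ x, g x 0 = t * a x := by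
  obtain ⟨β, hβ⟩ := hg
  obtain ⟨t, ht⟩ := hv.exists_smul_dependence (β 0)
  refine ⟨t, ?_, fun x => ?_⟩
  · rintro rfl
    exact β.ne_zero 0 (by simp [ht])
  · rw [hβ, ht]
    simp [hv.dependence_apply]

theorem IsAffineCircuit.comp_equiv {Y : Type*} [Fintype Y] (hv : IsAffineCircuit v a)
    (e : Y ≃ X) : IsAffineCircuit (v ∘ e) (a ∘ e) where
  sum_eq_zero := by
    simp only [Function.comp_apply]
    rw [e.sum_comp a, hv.sum_eq_zero]
  sum_smul_eq_zero := by
    simp only [Function.comp_apply]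
    rw [e.sum_comp fun x => a x • v x, hv.sum_smul_eq_zero]
  exists_smul b hb hb' := by
    obtain ⟨t, ht⟩ := hv.exists_smul (b ∘ e.symm)
      (by simp only [Function.comp_apply]; rw [e.symm.sum_comp b, hb])
      (by
        rw [← hb', ← e.sum_comp]
        simp)
    exact ⟨t, fun y => by simpa using ht (e y)⟩
  ne_zero y := hv.ne_zero (e y)

/-- Every Gale transform is `t * a` with `t ≠ 0`. Normalization leaves `sign t * sign (a x)`, so the
sign of `t` accounts for the reflection. -/
theorem IsAffineCircuit.exists_isGaleDiagram {K : Set E} [Fintype (Set.extremePoints ℝ K)]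
    [Nonempty (Set.extremePoints ℝ K)] {a : Set.extremePoints ℝ K → ℝ}
    (hv : IsAffineCircuit (fun x : Set.extremePoints ℝ K => (x : E)) a) :
    ∃ D : Set.extremePoints ℝ K → EuclideanSpace ℝ (Fin 1), IsGaleDiagram K D ∧
      (∀ D' : Set.extremePoints ℝ K → EuclideanSpace ℝ (Fin 1), IsGaleDiagram K D' →
        D' = D ∨ D' = -D) ∧
      (∀ x, D x = !₂[(1 : ℝ)] ↔ 0 < a x) ∧ (∀ x, D x = !₂[(-1 : ℝ)] ↔ a x < 0) := by
  have hval : ∀ (t : ℝ) (g : EuclideanSpace ℝ (Fin 1)) (x : Set.extremePoints ℝ K), t ≠ 0 →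
      g 0 = t * a x → ‖g‖⁻¹ • g = !₂[(SignType.sign t : ℝ) * SignType.sign (a x)] := by
    intro t g x ht hg
    refine inv_norm_smul_apply g |t * a x| _ ?_ (abs_pos.2 (mul_ne_zero ht (hv.ne_zero x))) ?_
    · rcases lt_or_gt_of_ne ht with h | h <;> rcases lt_or_gt_of_ne (hv.ne_zero x) with h' | h' <;>
        simp [h, h']
    · rw [hg, ← SignType.coe_mul, ← sign_mul, sign_mul_abs]
  have hne : (!₂[(1 : ℝ)] : EuclideanSpace ℝ (Fin 1)) ≠ !₂[(-1 : ℝ)] := by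
    intro h
    have : (1 : ℝ) = -1 := congrFun (congrArg WithLp.ofLp h) 0
    norm_num at this
  refine ⟨fun x => !₂[(SignType.sign (a x) : ℝ)], ⟨_, hv.isGaleTransform, fun x => ?_⟩,
    ?_, fun x => ?_, fun x => ?_⟩
  · rw [hval 1 _ x one_ne_zero (by simp)]
    simp
  · rintro D' ⟨g, hg, hD'⟩
    obtain ⟨t, ht, hgt⟩ := hv.exists_eq_of_isGaleTransform hg
    rcases lt_or_gt_of_ne ht with h | h
    · right
      funext x
      rw [hD', hval t _ x ht (hgt x)]
      ext i
      simp [h]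
    · left
      funext x
      rw [hD', hval t _ x ht (hgt x)]
      simp [h]
  · rcases lt_or_gt_of_ne (hv.ne_zero x) with h' | h'
    · simpa [h', h'.le.not_gt] using hne.symm
    · simp [h']
  · rcases lt_or_gt_of_ne (hv.ne_zero x) with h' | h'
    · simp [h']
    · simpa [h', h'.le.not_gt] using hne

end GaleDiagram

/-! ### Simplices, and the circuits coming from `T_k^n` -/

section Simplices

theorem affDim_convexHull {E : Type*} [AddCommGroup E] [Module ℝ E] (s : Set E) :
    affDim (convexHull ℝ s) = affDim s := by
  rw [affDim, affDim, ← direction_affineSpan, affineSpan_convexHull, direction_affineSpan]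

variable {n : ℕ} (b : AffineBasis (Fin (n + 1)) ℝ (EuclideanSpace ℝ (Fin n)))

/-- The facet of a simplex opposite to the vertex `b i`. -/
def oppositeFacet (i : Fin (n + 1)) : Set (EuclideanSpace ℝ (Fin n)) :=
  convexHull ℝ (b '' {i}ᶜ)

theorem dependence_eq_zero (w : Fin (n + 1) → ℝ) (h : ∑ i, w i = 0)
    (h' : ∑ i, w i • b i = 0) (i : Fin (n + 1)) : w i = 0 :=
  affineIndependent_iff.1 b.ind Finset.univ w h h' i (Finset.mem_univ i)

theorem isFace_oppositeFacet (i : Fin (n + 1)) :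
    IsFace (convexHull ℝ (Set.range b)) (oppositeFacet b i) ∧
      ∀ j, b j ∈ oppositeFacet b i ↔ j ≠ i := by
  -- Affinely independent points have no nontrivial dependences, so arbitrary heights are
  -- admissible.
  have := isFace_of_heights (v := b) (h := fun j => if j = i then 1 else 0)
    (fun w h h' => Finset.sum_eq_zero fun j _ => by simp [dependence_eq_zero b w h h' j])
    (fun j => by split_ifs <;> norm_num)
  have hS : {j | (if j = i then (1 : ℝ) else 0) = 0} = {i}ᶜ := by
    ext j
    simp
  rw [hS] at this
  exact ⟨this.1, fun j => by rw [oppositeFacet, this.2]; simp⟩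

theorem affDim_image (s : Finset (Fin (n + 1))) {m : ℕ} (hs : s.card = m + 1) :
    affDim (convexHull ℝ (b '' (s : Set (Fin (n + 1))))) = m := by
  classical
  rw [affDim_convexHull, affDim, ← Finset.coe_image]
  exact b.ind.finrank_vectorSpan_image_finset hs

theorem affDim_simplex : affDim (convexHull ℝ (Set.range b)) = n := by
  have := affDim_image b Finset.univ (m := n) (by simp)
  simpa using this

theorem isFacet_oppositeFacet (hn : 1 ≤ n) (i : Fin (n + 1)) :
    IsFacet (convexHull ℝ (Set.range b)) (oppositeFacet b i) := by
  have hcard : (({i}ᶜ : Finset (Fin (n + 1)))).card = n - 1 + 1 := by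
    rw [Finset.card_compl]
    simp
    omega
  refine ⟨(isFace_oppositeFacet b i).1, ?_, ?_⟩
  · obtain ⟨j, hj⟩ : ({i}ᶜ : Finset (Fin (n + 1))).Nonempty := by
      rw [← Finset.card_pos]
      omega
    exact ⟨b j, ((isFace_oppositeFacet b i).2 j).2 (by simpa using hj)⟩
  · have := affDim_image b _ hcard
    rw [Finset.coe_compl, Finset.coe_singleton] at this
    rw [affDim_simplex, oppositeFacet, this]
    omega

/-- The dimension of a nonempty face is one less than its number of vertices, so a facet misses
exactly one vertex. -/
theorem IsFacet.exists_eq_oppositeFacet {F : Set (EuclideanSpace ℝ (Fin n))}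
    (hF : IsFacet (convexHull ℝ (Set.range b)) F) : ∃ i, F = oppositeFacet b i := by
  classical
  obtain ⟨hface, hne, hdim⟩ := hF
  rw [affDim_simplex] at hdim
  have heq := hface.eq_convexHull_image
  obtain ⟨s, hs⟩ : ∃ s : Finset (Fin (n + 1)), (s : Set (Fin (n + 1))) = {i | b i ∈ F} :=
    ⟨Finset.univ.filter (fun i => b i ∈ F), by simp⟩
  rw [← hs] at heq
  have hspos : 0 < s.card := by
    rw [Finset.card_pos]
    by_contra hcon
    rw [Finset.not_nonempty_iff_eq_empty] at hcon
    rw [heq, hcon] at hne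
    simp at hne
  obtain ⟨m, hm⟩ : ∃ m, s.card = m + 1 := ⟨s.card - 1, by omega⟩
  have hdim' := affDim_image b s hm
  rw [← heq] at hdim'
  have hc : sᶜ.card = 1 := by
    rw [Finset.card_compl, Fintype.card_fin]
    omega
  obtain ⟨i, hi⟩ := Finset.card_eq_one.1 hc
  refine ⟨i, ?_⟩
  rw [heq, oppositeFacet, ← compl_compl s, hi, Finset.coe_compl, Finset.coe_singleton]

theorem oppositeFacet_injective : Function.Injective (oppositeFacet b) := by
  intro i j hij
  by_contra hne
  have h1 := (isFace_oppositeFacet b i).2 i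
  rw [hij, (isFace_oppositeFacet b j).2 i] at h1
  exact h1.1 hne rfl

/-- The affine function `l - c` vanishes at every vertex except `b i`, so it is a negative multiple
of the `i`-th barycentric coordinate. Hence being beyond or beneath a facet is read off from the
sign of that coordinate. -/
theorem apply_sub_eq_coord_mul {i : Fin (n + 1)} {l : StrongDual ℝ (EuclideanSpace ℝ (Fin n))}
    {c : ℝ} (hl : ∀ x ∈ convexHull ℝ (Set.range b), l x ≤ c)
    (hF : oppositeFacet b i = {x ∈ convexHull ℝ (Set.range b) | l x = c})
    (x : EuclideanSpace ℝ (Fin n)) :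
    l x - c = b.coord i x * (l (b i) - c) ∧ l (b i) - c < 0 := by
  have hmem : ∀ j, b j ∈ convexHull ℝ (Set.range b) := fun j =>
    subset_convexHull ℝ _ (Set.mem_range_self j)
  have hj : ∀ j, j ≠ i → l (b j) = c := by
    intro j hj
    have := ((isFace_oppositeFacet b i).2 j).2 hj
    rw [hF] at this
    exact this.2
  constructor
  · have hx := congrArg l (b.linear_combination_coord_eq_self x)
    rw [map_sum] at hx
    have h1 := b.sum_coord_apply_eq_one x
    calc l x - c = ∑ j, b.coord j x * (l (b j) - c) := by
          simp only [mul_sub, Finset.sum_sub_distrib, ← Finset.sum_mul, h1, one_mul, ← hx,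
            map_smul, smul_eq_mul]
      _ = _ := by
          refine Finset.sum_eq_single i (fun j _ h => ?_) (by simp)
          rw [hj j h, sub_self, mul_zero]
  · have hle := hl _ (hmem i)
    rcases hle.lt_or_eq with h | h
    · linarith
    · exfalso
      have h1 := (isFace_oppositeFacet b i).2 i
      rw [hF] at h1
      exact h1.1 ⟨hmem i, h⟩ rfl

theorem isBeyond_oppositeFacet_iff (hn : 1 ≤ n) (i : Fin (n + 1))
    (x : EuclideanSpace ℝ (Fin n)) :
    IsBeyond (convexHull ℝ (Set.range b)) (oppositeFacet b i) x ↔ b.coord i x < 0 := by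
  constructor
  · rintro ⟨l, c, hl, hF, hx⟩
    obtain ⟨h1, h2⟩ := apply_sub_eq_coord_mul b hl hF x
    by_contra! hcon
    have := mul_nonpos_of_nonneg_of_nonpos hcon h2.le
    linarith
  · intro hx
    obtain ⟨hface, hne, -⟩ := isFacet_oppositeFacet b hn i
    obtain ⟨l, c, hl, hF⟩ := hface.exists_functional hne
    obtain ⟨h1, h2⟩ := apply_sub_eq_coord_mul b hl hF x
    have := mul_pos_of_neg_of_neg hx h2
    exact ⟨l, c, hl, hF, by linarith⟩

theorem isBeneath_oppositeFacet_iff (hn : 1 ≤ n) (i : Fin (n + 1))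
    (x : EuclideanSpace ℝ (Fin n)) :
    IsBeneath (convexHull ℝ (Set.range b)) (oppositeFacet b i) x ↔ 0 < b.coord i x := by
  constructor
  · rintro ⟨l, c, hl, hF, hx⟩
    obtain ⟨h1, h2⟩ := apply_sub_eq_coord_mul b hl hF x
    by_contra! hcon
    have := mul_nonneg_of_nonpos_of_nonpos hcon h2.le
    linarith
  · intro hx
    obtain ⟨hface, hne, -⟩ := isFacet_oppositeFacet b hn i
    obtain ⟨l, c, hl, hF⟩ := hface.exists_functional hne
    obtain ⟨h1, h2⟩ := apply_sub_eq_coord_mul b hl hF x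
    have := mul_neg_of_pos_of_neg hx h2
    exact ⟨l, c, hl, hF, by linarith⟩

theorem ncard_facets_beyond (hn : 1 ≤ n) (x : EuclideanSpace ℝ (Fin n)) :
    {F | IsFacet (convexHull ℝ (Set.range b)) F ∧
      IsBeyond (convexHull ℝ (Set.range b)) F x}.ncard = {i | b.coord i x < 0}.ncard := by
  rw [← Set.ncard_image_of_injective _ (oppositeFacet_injective b)]
  congr 1
  ext F
  constructor
  · rintro ⟨hF, hx⟩
    obtain ⟨i, rfl⟩ := hF.exists_eq_oppositeFacet b
    exact ⟨i, (isBeyond_oppositeFacet_iff b hn i x).1 hx, rfl⟩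
  · rintro ⟨i, hi, rfl⟩
    exact ⟨isFacet_oppositeFacet b hn i, (isBeyond_oppositeFacet_iff b hn i x).2 hi⟩

theorem IsSimplex.exists_affineBasis {Δ : Set (EuclideanSpace ℝ (Fin n))}
    (h : IsSimplex n Δ) : ∃ b : AffineBasis (Fin (n + 1)) ℝ (EuclideanSpace ℝ (Fin n)),
      Δ = convexHull ℝ (Set.range b) := by
  obtain ⟨p, hp, rfl⟩ := h
  exact ⟨⟨p, hp, hp.affineSpan_eq_top_iff_card_eq_finrank_add_one.2 (by simp)⟩, rfl⟩

/-- A point with nonzero barycentric coordinates forms an affine circuit together with the vertices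
of the simplex. -/
theorem isAffineCircuit_option (x : EuclideanSpace ℝ (Fin n)) (hx : ∀ i, b.coord i x ≠ 0) :
    IsAffineCircuit (fun i : Option (Fin (n + 1)) => i.elim x b)
      (fun i => i.elim 1 fun j => -b.coord j x) where
  sum_eq_zero := by simp [Fintype.sum_option, b.sum_coord_apply_eq_one]
  sum_smul_eq_zero := by
    simp [Fintype.sum_option, b.linear_combination_coord_eq_self]
  exists_smul w h h' := by
    simp only [Fintype.sum_option, Option.elim_none, Option.elim_some] at h h'
    -- Replacing `x` by its barycentric expansion turns the dependence into one between the vertices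
    -- of the simplex.
    have key := dependence_eq_zero b (fun j => w (some j) + w none * b.coord j x)
      (by rw [Finset.sum_add_distrib, ← Finset.mul_sum, b.sum_coord_apply_eq_one]; linarith)
      (by
        simp only [add_smul, Finset.sum_add_distrib, mul_smul]
        rw [← Finset.smul_sum, b.linear_combination_coord_eq_self, add_comm]
        exact h')
    refine ⟨w none, fun i => ?_⟩
    cases i with
    | none => simp
    | some j =>
      have := key j
      simp only [Option.elim_some]
      linarith
  ne_zero i := by
    cases i with
    | none => simp
    | some j => simpa using hx j

theorem convexHull_insert_convexHull {E : Type*} [AddCommGroup E] [Module ℝ E] (x : E)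
    (s : Set E) : convexHull ℝ (insert x (convexHull ℝ s)) = convexHull ℝ (insert x s) := by
  rw [Set.insert_eq, convexHull_convexHull_union_right, ← Set.insert_eq]

/-- Being beyond or beneath every facet excludes zero coordinates. The positive coefficients are
that of the added point and those of the vertices opposite the `k` facets it is beyond, whence `k +
1`. -/
theorem IsT.exists_isAffineCircuit {k : ℕ} (hn : 1 ≤ n) {K : Set (EuclideanSpace ℝ (Fin n))}
    (hK : IsT n k K) : ∃ (v : Option (Fin (n + 1)) → EuclideanSpace ℝ (Fin n))
      (a : Option (Fin (n + 1)) → ℝ), IsAffineCircuit v a ∧ K = convexHull ℝ (Set.range v) ∧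
        {i | 0 < a i}.ncard = k + 1 := by
  obtain ⟨Δ, x, hΔ, -, hk, hbeneath, rfl⟩ := hK
  obtain ⟨b, rfl⟩ := hΔ.exists_affineBasis
  rw [ncard_facets_beyond b hn] at hk
  have hx : ∀ i, b.coord i x ≠ 0 := by
    intro i hi
    have h1 := hbeneath _ (isFacet_oppositeFacet b hn i)
    rw [isBeyond_oppositeFacet_iff b hn, isBeneath_oppositeFacet_iff b hn, hi] at h1
    simp at h1
  refine ⟨_, _, isAffineCircuit_option b x hx, ?_, ?_⟩
  · rw [convexHull_insert_convexHull]
    congr 1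
    ext y
    simp [Option.exists, eq_comm]
  · have : {i : Option (Fin (n + 1)) | 0 < (i.elim 1 fun j => -b.coord j x : ℝ)} =
        insert none (some '' {i | b.coord i x < 0}) := by
      ext i
      cases i <;> simp
    rw [this, Set.ncard_insert_of_notMem (by simp),
      Set.ncard_image_of_injective _ (Option.some_injective _), hk]

theorem exists_isT {k : ℕ} (hk : 1 ≤ k) (hkn : k ≤ n) :
    ∃ K : Set (EuclideanSpace ℝ (Fin n)), IsT n k K := by
  have hn : 1 ≤ n := hk.trans hkn
  obtain ⟨b⟩ : Nonempty (AffineBasis (Fin (n + 1)) ℝ (EuclideanSpace ℝ (Fin n))) :=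
    AffineBasis.exists_affineBasis_of_finiteDimensional (by simp)
  have hpos : (0 : ℝ) < (k + 1) / (n + 1 - k) := by
    have : (k : ℝ) ≤ n := by exact_mod_cast hkn
    apply div_pos <;> linarith [(Nat.cast_nonneg k : (0 : ℝ) ≤ k)]
  -- Barycentric coordinates: `k` of them are `-1`, and the other `n + 1 - k` are equal and
  -- positive, with value fixed by the total `1`.
  let w : Fin (n + 1) → ℝ := fun i => if i.val < k then -1 else (k + 1) / (n + 1 - k)
  have hcard : (Finset.univ.filter fun i : Fin (n + 1) => i.val < k).card = k := by
    rw [Fin.card_filter_val_lt]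
    omega
  have hw : ∑ i, w i = 1 := by
    have h' : (Finset.univ.filter fun i : Fin (n + 1) => ¬ i.val < k).card = n + 1 - k := by
      have := Finset.card_filter_add_card_filter_not (s := Finset.univ)
        (fun i : Fin (n + 1) => i.val < k)
      rw [hcard, Finset.card_univ, Fintype.card_fin] at this
      omega
    simp only [w]
    rw [Finset.sum_ite, Finset.sum_const, Finset.sum_const, hcard, h', nsmul_eq_mul, nsmul_eq_mul,
      Nat.cast_sub (by omega)]
    have : (n + 1 - k : ℝ) ≠ 0 := by
      have : (k : ℝ) ≤ n := by exact_mod_cast hkn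
      linarith
    push_cast
    field_simp
    ring
  let x := Finset.univ.affineCombination ℝ b w
  have hx : ∀ i, b.coord i x = w i := fun i =>
    b.coord_apply_combination_of_mem (Finset.mem_univ i) hw
  have hneg : ∀ i, w i < 0 ↔ i.val < k := by
    intro i
    simp only [w]
    split_ifs with h
    · simp [h]
    · simp [h, hpos.le]
  refine ⟨_, convexHull ℝ (Set.range b), x, ⟨b, b.ind, rfl⟩, ?_, ?_, ?_, rfl⟩
  · rw [b.convexHull_eq_nonneg_coord]
    intro h
    have h0 : w 0 < 0 := (hneg 0).2 (by rw [Fin.val_zero]; omega)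
    rw [← hx] at h0
    exact absurd (h 0) h0.not_ge
  · rw [ncard_facets_beyond b hn]
    simp only [hx, hneg]
    rw [← Set.ncard_coe_finset, Finset.coe_filter_univ] at hcard
    exact hcard
  · intro F hF
    obtain ⟨i, rfl⟩ := hF.exists_eq_oppositeFacet b
    rw [isBeyond_oppositeFacet_iff b hn, isBeneath_oppositeFacet_iff b hn, hx, hneg]
    intro h
    simpa [w, h] using hpos

end Simplices

theorem exists_equiv_of_ncard_eq {ι κ : Type*} [Finite ι] [Finite κ] {p : ι → Prop}
    {q : κ → Prop} (h : Nat.card ι = Nat.card κ) (hpq : {i | p i}.ncard = {i | q i}.ncard) :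
    ∃ e : ι ≃ κ, ∀ i, p i ↔ q (e i) := by
  classical
  have hc : {i | p i}ᶜ.ncard = {i | q i}ᶜ.ncard := by
    have h1 := Set.ncard_add_ncard_compl {i | p i}
    have h2 := Set.ncard_add_ncard_compl {i | q i}
    omega
  obtain ⟨e₁⟩ : Nonempty ({i // p i} ≃ {i // q i}) :=
    (Finite.card_eq (α := {i // p i}) (β := {i // q i})).1 hpq
  obtain ⟨e₂⟩ : Nonempty ({i // ¬ p i} ≃ {i // ¬ q i}) :=
    (Finite.card_eq (α := {i // ¬ p i}) (β := {i // ¬ q i})).1 hc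
  refine ⟨(Equiv.sumCompl p).symm.trans ((Equiv.sumCongr e₁ e₂).trans (Equiv.sumCompl q)),
    fun i => ?_⟩
  by_cases hi : p i
  · simp [hi, (e₁ ⟨i, hi⟩).2]
  · simp [hi, (e₂ ⟨i, hi⟩).2]

/-! ### Polytopes are cut out by their facets -/

section FacetRepresentation

variable {E : Type*} [NormedAddCommGroup E] [NormedSpace ℝ E]

theorem IsPolytope.isCompact {K : Set E} (hK : IsPolytope K) : IsCompact K := by
  obtain ⟨s, hs, rfl⟩ := hK
  exact hs.isCompact_convexHull ℝ

theorem IsPolytope.convex {K : Set E} (hK : IsPolytope K) : Convex ℝ K := by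
  obtain ⟨s, hs, rfl⟩ := hK
  exact convex_convexHull ℝ s

/-- A nonempty open set contains a point outside all the flats of positive codimension spanned by
`x` and a subset of the finite set `s`. -/
theorem exists_mem_notMem_affineSpan [FiniteDimensional ℝ E] {U s : Set E} (hU : IsOpen U)
    (hUne : U.Nonempty) (hs : s.Finite) (x : E) :
    ∃ y ∈ U, ∀ t ⊆ s, Module.finrank ℝ (vectorSpan ℝ t) + 2 ≤ Module.finrank ℝ E →
      y ∉ affineSpan ℝ (insert x t) := by
  borelize E
  have hfin : {t | t ⊆ s ∧ Module.finrank ℝ (vectorSpan ℝ t) + 2 ≤ Module.finrank ℝ E}.Finite :=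
    hs.finite_subsets.subset fun t ht => ht.1
  -- Adding `x` raises the dimension by at most one, so these finitely many flats are proper and
  -- null, while a nonempty open set has positive measure.
  have hnull : (MeasureTheory.Measure.addHaar : MeasureTheory.Measure E)
      (⋃ t ∈ {t | t ⊆ s ∧ Module.finrank ℝ (vectorSpan ℝ t) + 2 ≤ Module.finrank ℝ E},
        (affineSpan ℝ (insert x t) : Set E)) = 0 := by
    rw [MeasureTheory.measure_biUnion_null_iff hfin.countable]
    rintro t ⟨-, ht⟩
    apply MeasureTheory.Measure.addHaar_affineSubspace
    intro htop
    have h1 := finrank_vectorSpan_insert_le_set ℝ t x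
    have h2 : vectorSpan ℝ (insert x t) = ⊤ := by
      rw [← direction_affineSpan, htop, AffineSubspace.direction_top]
    rw [h2, finrank_top] at h1
    omega
  by_contra! hcon
  have hsub : U ⊆ ⋃ t ∈ {t | t ⊆ s ∧
      Module.finrank ℝ (vectorSpan ℝ t) + 2 ≤ Module.finrank ℝ E},
        (affineSpan ℝ (insert x t) : Set E) := by
    intro y hy
    obtain ⟨t, ht, hd, hyt⟩ := hcon y hy
    exact Set.mem_biUnion ⟨ht, hd⟩ hyt
  exact (hU.measure_pos _ hUne).ne' (MeasureTheory.measure_mono_null hsub hnull)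

/-- A point outside a full-dimensional polytope is beyond some facet. -/
theorem exists_isFacet_lt [FiniteDimensional ℝ E] {K : Set E} (hK : IsPolytope K)
    (hdim : affDim K = Module.finrank ℝ E) (hd : 0 < Module.finrank ℝ E) {x : E} (hx : x ∉ K) :
    ∃ F, IsFacet K F ∧ ∀ (l : StrongDual ℝ E) (c : ℝ), (∀ y ∈ K, l y ≤ c) →
      F = {y ∈ K | l y = c} → c < l x := by
  have hKc := hK.isCompact
  have hKconv := hK.convex
  obtain ⟨s, hs, rfl⟩ := hK
  have hspan : vectorSpan ℝ s = ⊤ := by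
    apply Submodule.eq_top_of_finrank_eq
    rwa [affDim_convexHull] at hdim
  have hsne : s.Nonempty := by
    by_contra hcon
    rw [Set.not_nonempty_iff_eq_empty] at hcon
    rw [hcon, convexHull_empty, affDim, vectorSpan_empty, finrank_bot] at hdim
    omega
  have hint : (interior (convexHull ℝ s)).Nonempty := by
    rw [interior_convexHull_nonempty_iff_affineSpan_eq_top,
      AffineSubspace.affineSpan_eq_top_iff_vectorSpan_eq_top_of_nonempty _ _ _ hsne, hspan]
  -- The segment from a generic interior point `y` to `x` meets the boundary at `z`; genericity will
  -- make a supporting hyperplane at `z` cut out a facet.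
  obtain ⟨y, hy, hgen⟩ := exists_mem_notMem_affineSpan isOpen_interior hint hs x
  obtain ⟨z, hzseg, hzK, hzint⟩ : ∃ z ∈ segment ℝ y x, z ∈ convexHull ℝ s ∧
      z ∉ interior (convexHull ℝ s) := by
    by_contra! hcon
    obtain ⟨w, -, hw1, hw2⟩ := (convex_segment y x).isPreconnected _ _
      (isOpen_interior (s := convexHull ℝ s)) hKc.isClosed.isOpen_compl
      (fun w hw => by
        by_cases h : w ∈ convexHull ℝ s
        · exact Or.inl (hcon w hw h)
        · exact Or.inr h)
      ⟨y, left_mem_segment ℝ y x, hy⟩ ⟨x, right_mem_segment ℝ y x, hx⟩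
    exact hw2 (interior_subset hw1)
  obtain ⟨f, hf⟩ := geometric_hahn_banach_open_point hKconv.interior isOpen_interior hzint
  have hfK : ∀ w ∈ convexHull ℝ s, f w ≤ f z := by
    intro w hw
    have : w ∈ closure (interior (convexHull ℝ s)) := by
      rw [hKconv.closure_interior_eq_closure_of_nonempty_interior hint]
      exact subset_closure hw
    exact closure_minimal (fun u hu => (hf u hu).le)
      (isClosed_le f.continuous continuous_const) this
  have hface := isFace_sep f hfK
  have hzF : z ∈ {w ∈ convexHull ℝ s | f w = f z} := ⟨hzK, rfl⟩
  obtain ⟨a, b, ha, hb, hab, hz⟩ := hzseg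
  have hb1 : b ≠ 1 := by
    rintro rfl
    obtain rfl : a = 0 := by linarith
    apply hx
    rw [← hz] at hzK
    simpa using hzK
  have ha0 : 0 < a := lt_of_le_of_ne ha fun h => hb1 (by linarith)
  refine ⟨_, ⟨hface, ⟨z, hzF⟩, ?_⟩, ?_⟩
  · rw [hdim]
    apply le_antisymm
    · have hle : vectorSpan ℝ {w ∈ convexHull ℝ s | f w = f z} ≤ (f : E →ₗ[ℝ] ℝ).ker := by
        rw [vectorSpan_def, Submodule.span_le]
        rintro _ ⟨u, hu, w, hw, rfl⟩
        simp [hu.2, hw.2]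
      have hlt : (f : E →ₗ[ℝ] ℝ).ker < ⊤ := by
        rw [lt_top_iff_ne_top]
        intro htop
        have h0 : ∀ w, f w = 0 := fun w => by
          have : w ∈ (f : E →ₗ[ℝ] ℝ).ker := htop ▸ Submodule.mem_top
          simpa using this
        have := hf y hy
        rw [h0, h0] at this
        exact lt_irrefl _ this
      exact (Submodule.finrank_mono hle).trans_lt (Submodule.finrank_lt hlt.ne)
    -- If the face had codimension at least two, `y`, lying on the line through `x` and `z`, would
    -- belong to the flat spanned by `x` and the generators on the face.
    · by_contra! hcon
      have heq := hface.eq_convexHull_inter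
      rw [heq, affDim_convexHull, affDim] at hcon
      refine hgen (s ∩ {w ∈ convexHull ℝ s | f w = f z}) Set.inter_subset_left (by omega) ?_
      have hzA : z ∈ affineSpan ℝ (insert x (s ∩ {w ∈ convexHull ℝ s | f w = f z})) := by
        apply affineSpan_mono ℝ (Set.subset_insert x _)
        apply convexHull_subset_affineSpan
        rw [← heq]
        exact hzF
      have hxA : x ∈ affineSpan ℝ (insert x (s ∩ {w ∈ convexHull ℝ s | f w = f z})) :=
        subset_affineSpan ℝ _ (Set.mem_insert x _)
      have hyeq : y = AffineMap.lineMap x z a⁻¹ := by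
        rw [AffineMap.lineMap_apply_module, ← hz, smul_add, smul_smul, smul_smul,
          inv_mul_cancel₀ ha0.ne', one_smul, add_left_comm, ← add_smul]
        have : 1 - a⁻¹ + a⁻¹ * b = 0 := by
          field_simp
          linarith
        rw [this, zero_smul, add_zero]
      rw [hyeq]
      exact AffineMap.lineMap_mem _ hxA hzA
  · intro l c hl hF
    have hlz : l z = c := by
      rw [hF] at hzF
      exact hzF.2
    -- Since `l z = c` at a point `z` between `y` and `x`, strictness at `y` forces `c < l x`.
    have hly : l y < c := by
      refine lt_of_le_of_ne (hl y (interior_subset hy)) fun h => ?_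
      have : y ∈ {w ∈ convexHull ℝ s | f w = f z} := by
        rw [hF]
        exact ⟨interior_subset hy, h⟩
      exact (hf y hy).ne this.2
    by_contra! hcon
    have h1 := mul_lt_mul_of_pos_left hly ha0
    have h2 := mul_le_mul_of_nonneg_left hcon hb
    have h3 : l z = a * l y + b * l x := by simp [← hz]
    have h4 : a * c + b * c = c := by rw [← add_mul, hab, one_mul]
    linarith

theorem IsPolytope.finite_extremePoints {K : Set E} (hK : IsPolytope K) :
    (Set.extremePoints ℝ K).Finite := by
  obtain ⟨s, hs, rfl⟩ := hK
  exact hs.subset extremePoints_convexHull_subset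

theorem IsPolytope.eq_convexHull_extremePoints {K : Set E} (hK : IsPolytope K) :
    K = convexHull ℝ (Set.extremePoints ℝ K) := by
  conv_lhs => rw [← closure_convexHull_extremePoints hK.isCompact hK.convex]
  exact (hK.finite_extremePoints.isCompact_convexHull ℝ).isClosed.closure_eq

theorem IsPolytope.face_eq_convexHull {K F : Set E} (hK : IsPolytope K) (hF : IsFace K F) :
    F = convexHull ℝ (Set.extremePoints ℝ K ∩ F) := by
  have h := hK.eq_convexHull_extremePoints
  generalize Set.extremePoints ℝ K = s at h
  subst h
  exact hF.eq_convexHull_inter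

theorem IsPolytope.finite_facets {K : Set E} (hK : IsPolytope K) :
    Finite {F : Set E // IsFacet K F} := by
  have : Finite {t : Set E // t ⊆ Set.extremePoints ℝ K} :=
    hK.finite_extremePoints.finite_subsets.to_subtype
  refine Finite.of_injective (β := {t : Set E // t ⊆ Set.extremePoints ℝ K})
    (fun F => ⟨Set.extremePoints ℝ K ∩ F.1, Set.inter_subset_left⟩) fun F G h => ?_
  apply Subtype.ext
  rw [hK.face_eq_convexHull F.2.1, hK.face_eq_convexHull G.2.1,
    show Set.extremePoints ℝ K ∩ F.1 = Set.extremePoints ℝ K ∩ G.1 from congrArg Subtype.val h]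

/-- A system of supporting functionals of the facets of `K`, which cuts out `K`. -/
structure IsFacetSystem (K : Set E) (l : {F : Set E // IsFacet K F} → StrongDual ℝ E)
    (c : {F : Set E // IsFacet K F} → ℝ) : Prop where
  le : ∀ F, ∀ x ∈ K, l F x ≤ c F
  mem_facet_iff : ∀ F x, x ∈ F.1 ↔ x ∈ K ∧ l F x = c F
  mem_of_le : ∀ x, (∀ F, l F x ≤ c F) → x ∈ K

theorem IsPolytope.exists_isFacetSystem [FiniteDimensional ℝ E] {K : Set E}
    (hK : IsPolytope K)
    (hdim : affDim K = Module.finrank ℝ E) (hd : 0 < Module.finrank ℝ E) :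
    ∃ l c, IsFacetSystem K l c := by
  choose l c hle heq using fun F : {F : Set E // IsFacet K F} =>
    F.2.1.exists_functional F.2.2.1
  refine ⟨l, c, hle, fun F x => ?_, fun x hx => ?_⟩
  · have := heq F
    constructor
    · intro h
      rw [this] at h
      exact h
    · intro h
      rw [this]
      exact h
  · by_contra hcon
    obtain ⟨F, hF, hlt⟩ := exists_isFacet_lt hK hdim hd hcon
    exact (hlt _ _ (hle ⟨F, hF⟩) (heq ⟨F, hF⟩)).not_ge (hx ⟨F, hF⟩)

variable {K : Set E} {l : {F : Set E // IsFacet K F} → StrongDual ℝ E}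
  {c : {F : Set E // IsFacet K F} → ℝ}

/-- Facets through `x` are not crossed in direction `d`, and the finitely many others have slack at
`x`. -/
theorem IsFacetSystem.exists_pos_add_smul_mem [Finite {F : Set E // IsFacet K F}]
    (h : IsFacetSystem K l c) {x d : E} (hx : x ∈ K) (hd : ∀ F, x ∈ F.1 → l F d ≤ 0) :
    ∃ ε : ℝ, 0 < ε ∧ x + ε • d ∈ K := by
  have key : ∀ᶠ ε : ℝ in nhdsWithin 0 (Set.Ioi 0), ∀ F, l F (x + ε • d) ≤ c F := by
    rw [Filter.eventually_all]
    intro F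
    by_cases hF : x ∈ F.1
    · filter_upwards [self_mem_nhdsWithin] with ε hε
      have := mul_nonpos_of_nonneg_of_nonpos (le_of_lt hε) (hd F hF)
      have h' := h.le F x hx
      simp only [map_add, map_smul, smul_eq_mul]
      linarith
    · have hlt : l F x < c F :=
        lt_of_le_of_ne (h.le F x hx) fun heq => hF ((h.mem_facet_iff F x).2 ⟨hx, heq⟩)
      have hcont : Continuous fun ε : ℝ => l F (x + ε • d) := by fun_prop
      have := (hcont.tendsto 0).eventually_lt_const (by simpa using hlt)
      exact nhdsWithin_le_nhds (this.mono fun ε hε => hε.le)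
  obtain ⟨ε, hε, hε'⟩ := (key.and self_mem_nhdsWithin).exists
  exact ⟨ε, hε', h.mem_of_le _ hε⟩

/-- A direction parallel to all facets at `x` could be followed both ways inside `K`, putting `x` in
an open segment. -/
theorem IsFacetSystem.eq_zero_of_mem_extremePoints [Finite {F : Set E // IsFacet K F}]
    (h : IsFacetSystem K l c) {x d : E} (hx : x ∈ Set.extremePoints ℝ K)
    (hd : ∀ F, x ∈ F.1 → l F d = 0) : d = 0 := by
  obtain ⟨ε, hε, h1⟩ := h.exists_pos_add_smul_mem hx.1 fun F hF => (hd F hF).le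
  obtain ⟨δ, hδ, h2⟩ := h.exists_pos_add_smul_mem (d := -d) hx.1 fun F hF => by
    simp [hd F hF]
  have hmem : x ∈ openSegment ℝ (x + ε • d) (x + δ • -d) := by
    refine ⟨δ / (ε + δ), ε / (ε + δ), by positivity, by positivity, by field_simp; ring, ?_⟩
    have hne : ε + δ ≠ 0 := by positivity
    simp only [smul_add, smul_smul, smul_neg]
    rw [add_add_add_comm, ← add_smul, show δ / (ε + δ) + ε / (ε + δ) = 1 by field_simp; ring,
      show δ / (ε + δ) * ε = ε / (ε + δ) * δ by ring]
    simp
  have := hx.2 h1 h2 hmem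
  rw [add_eq_left, smul_eq_zero] at this
  exact this.resolve_left hε.ne'

end FacetRepresentation

/-! ### Local coordinates at the vertices -/

section Charts

variable {P : Set Space} {col : Facet P → Fin 3}

/-- Local coordinates of a 3-face-coloured simple 3-polytope at its vertices: `fac v i` is the facet
of colour `i` at the vertex `v` and `e v i` is the direction of the edge at `v` which leaves that
facet. -/
structure IsVertexChart (P : Set Space) (col : Facet P → Fin 3)
    (l : Facet P → StrongDual ℝ Space) (c : Facet P → ℝ)
    (fac : Vert P → Fin 3 → Facet P) (e : Vert P → Fin 3 → Space) : Prop where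
  isFacetSystem : IsFacetSystem P l c
  mem_iff : ∀ (v : Vert P) (F : Facet P), (v : Space) ∈ F.1 ↔ fac v (col F) = F
  col_fac : ∀ v i, col (fac v i) = i
  sub_eq : ∀ (v : Vert P) (x : Space),
    x - v = ∑ i, (c (fac v i) - l (fac v i) x) • e v i
  exists_pos : ∀ (v : Vert P) (i : Fin 3), ∃ ε : ℝ, 0 < ε ∧ (v : Space) + ε • e v i ∈ P
  ne_zero : ∀ v i, e v i ≠ 0
  apply_of_ne : ∀ v i j, j ≠ i → l (fac v j) (e v i) = 0

theorem IsSimple3Polytope.finite_facet (hP : IsSimple3Polytope P) : Finite (Facet P) :=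
  hP.1.finite_facets

theorem IsSimple3Polytope.finite_vert (hP : IsSimple3Polytope P) : Finite (Vert P) :=
  hP.1.finite_extremePoints.to_subtype

theorem IsSimple3Polytope.exists_facets (hP : IsSimple3Polytope P) (v : Vert P) :
    ∃ f : Fin 3 → Facet P, Function.Injective f ∧
      ∀ F : Facet P, (v : Space) ∈ F.1 ↔ ∃ i, f i = F := by
  have hcard : Nat.card {F : Facet P // (v : Space) ∈ F.1} = 3 := by
    refine Eq.trans ?_ (hP.2.2 v v.2)
    exact Nat.card_congr (Equiv.subtypeSubtypeEquivSubtypeInter (IsFacet P)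
      fun F => (v : Space) ∈ F)
  have hfin : Finite {F : Facet P // (v : Space) ∈ F.1} := Nat.finite_of_card_ne_zero (by omega)
  let g : Fin 3 ≃ {F : Facet P // (v : Space) ∈ F.1} := (Finite.equivFinOfCardEq hcard).symm
  refine ⟨fun i => (g i).1, fun i j h => g.injective (Subtype.ext h), fun F => ?_⟩
  constructor
  · intro hF
    exact ⟨g.symm ⟨F, hF⟩, by simp⟩
  · rintro ⟨i, rfl⟩
    exact (g i).2

/-- Extremality of `v` makes the three facet functionals jointly injective on `ℝ³`, hence a
coordinate system. The `e i` are the dual basis up to sign; `-1` makes them point into `P`. -/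
theorem IsFacetSystem.exists_edges (hP : IsSimple3Polytope P) {l : Facet P → StrongDual ℝ Space}
    {c : Facet P → ℝ} (h : IsFacetSystem P l c) (v : Vert P) {f : Fin 3 → Facet P}
    (hf : ∀ F : Facet P, (v : Space) ∈ F.1 ↔ ∃ i, f i = F) :
    ∃ e : Fin 3 → Space, (∀ i j, l (f j) (e i) = if j = i then -1 else 0) ∧
      ∀ x : Space, x - v = ∑ i, (c (f i) - l (f i) x) • e i := by
  have := hP.finite_facet
  let Λ : Space →ₗ[ℝ] (Fin 3 → ℝ) := LinearMap.pi fun i => (l (f i) : Space →ₗ[ℝ] ℝ)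
  have hΛ : ∀ x i, Λ x i = l (f i) x := fun x i => rfl
  have hinj : Function.Injective Λ := by
    rw [← LinearMap.ker_eq_bot, LinearMap.ker_eq_bot']
    intro d hd
    refine h.eq_zero_of_mem_extremePoints v.2 fun F hF => ?_
    obtain ⟨i, rfl⟩ := (hf F).1 hF
    rw [← hΛ, hd, Pi.zero_apply]
  have hsurj : Function.Surjective Λ :=
    (LinearMap.injective_iff_surjective_of_finrank_eq_finrank (by simp)).1 hinj
  choose e he using fun i : Fin 3 => hsurj fun j => if j = i then -1 else 0
  have he' : ∀ i j, l (f j) (e i) = if j = i then -1 else 0 := fun i j => by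
    rw [← hΛ, he]
  refine ⟨e, he', fun x => hinj ?_⟩
  ext j
  have hv : l (f j) v = c (f j) := ((h.mem_facet_iff _ _).1 ((hf (f j)).2 ⟨j, rfl⟩)).2
  rw [hΛ, hΛ, map_sub, hv, map_sum]
  simp [he']

theorem affDim_eq_one {A : Set Space} {v d : Space} {ε : ℝ} (hd : d ≠ 0) (hε : 0 < ε)
    (hv : v ∈ A) (hvd : v + ε • d ∈ A) (hA : ∀ x ∈ A, ∃ t : ℝ, x - v = t • d) :
    affDim A = 1 := by
  have : vectorSpan ℝ A = Submodule.span ℝ {d} := by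
    apply le_antisymm
    · rw [vectorSpan_def, Submodule.span_le]
      rintro _ ⟨x, hx, y, hy, rfl⟩
      obtain ⟨s, hs⟩ := hA x hx
      obtain ⟨t, ht⟩ := hA y hy
      rw [SetLike.mem_coe, Submodule.mem_span_singleton]
      refine ⟨s - t, ?_⟩
      simp only [sub_smul, ← hs, ← ht, vsub_eq_sub]
      abel
    · rw [Submodule.span_singleton_le_iff_mem]
      have := vsub_mem_vectorSpan ℝ hvd hv
      rw [vsub_eq_sub, add_sub_cancel_left] at this
      exact (Submodule.smul_mem_iff _ hε.ne').1 this
  rw [affDim, this, finrank_span_singleton hd]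

/-- Any two facets at `v` share the edge in the direction belonging to the third one, so their
colours differ. The three facets at `v` can thus be indexed by colour. -/
theorem exists_isVertexChart (hP : IsSimple3Polytope P) (hcol : IsFaceColouring P col) :
    ∃ l c fac e, IsVertexChart P col l c fac e := by
  have := hP.finite_facet
  obtain ⟨l, c, h⟩ := hP.1.exists_isFacetSystem (by rw [hP.2.1]; simp) (by simp)
  have key : ∀ v : Vert P, ∃ (fac : Fin 3 → Facet P) (e : Fin 3 → Space),
      (∀ F : Facet P, (v : Space) ∈ F.1 ↔ fac (col F) = F) ∧ (∀ i, col (fac i) = i) ∧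
      (∀ x : Space, x - v = ∑ i, (c (fac i) - l (fac i) x) • e i) ∧
      (∀ i j, l (fac j) (e i) = if j = i then -1 else 0) := by
    intro v
    obtain ⟨f, hinj, hf⟩ := hP.exists_facets v
    obtain ⟨e, he, hsub⟩ := h.exists_edges hP v hf
    have hcolf : Function.Injective (col ∘ f) := by
      intro i j hij
      by_contra hne
      obtain ⟨k, hki, hkj⟩ : ∃ k : Fin 3, k ≠ i ∧ k ≠ j := by
        clear hij
        decide +revert
      have hothers : ∀ m : Fin 3, m ≠ k → m = i ∨ m = j := by
        clear hij
        decide +revert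
      have hek : e k ≠ 0 := by
        intro h0
        have := he k k
        rw [h0, map_zero] at this
        simp at this
      obtain ⟨ε, hε, hmem⟩ := h.exists_pos_add_smul_mem v.2.1 (d := e k) fun F hF => by
        obtain ⟨m, rfl⟩ := (hf F).1 hF
        rw [he]
        split_ifs <;> norm_num
      have hv : ∀ m, (v : Space) ∈ (f m).1 := fun m => (hf _).2 ⟨m, rfl⟩
      have hedge : ∀ m, m ≠ k → (v : Space) + ε • e k ∈ (f m).1 := by
        intro m hm
        rw [h.mem_facet_iff]
        refine ⟨hmem, ?_⟩
        rw [map_add, map_smul, he, if_neg hm, smul_zero, add_zero]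
        exact ((h.mem_facet_iff _ _).1 (hv m)).2
      refine hcol (f i) (f j) (fun heq => hne (hinj heq)) ?_ hij
      refine affDim_eq_one hek hε ⟨hv i, hv j⟩ ⟨hedge i hki.symm, hedge j hkj.symm⟩ ?_
      rintro x ⟨hxi, hxj⟩
      refine ⟨c (f k) - l (f k) x, ?_⟩
      rw [hsub x]
      refine Finset.sum_eq_single k (fun m _ hm => ?_) (by simp)
      have hxm : x ∈ (f m).1 := by
        rcases hothers m hm with rfl | rfl
        · exact hxi
        · exact hxj
      rw [((h.mem_facet_iff _ _).1 hxm).2, sub_self, zero_smul]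
    let σ : Fin 3 ≃ Fin 3 := Equiv.ofBijective _ (Finite.injective_iff_bijective.1 hcolf)
    have hσ : ∀ i, col (f (σ.symm i)) = i := fun i => σ.apply_symm_apply i
    have hσ' : ∀ i, σ.symm (col (f i)) = i := fun i => σ.symm_apply_apply i
    refine ⟨fun i => f (σ.symm i), fun i => e (σ.symm i), fun F => ?_, hσ, fun x => ?_, ?_⟩
    · rw [hf]
      constructor
      · rintro ⟨i, rfl⟩
        exact congrArg f (hσ' i)
      · exact fun hF => ⟨_, hF⟩
    · rw [hsub x]
      exact (σ.symm.sum_comp fun i => (c (f i) - l (f i) x) • e i).symm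
    · intro i j
      rw [he]
      simp
  choose fac e hmem hcolfac hsub he using key
  refine ⟨l, c, fac, e, h, hmem, hcolfac, hsub, fun v i => ?_, fun v i h0 => ?_,
    fun v i j hij => ?_⟩
  · refine h.exists_pos_add_smul_mem v.2.1 fun F hF => ?_
    rw [hmem] at hF
    rw [← hF, he]
    split_ifs <;> norm_num
  · have := he v i i
    rw [h0, map_zero] at this
    simp at this
  · rw [he, if_neg hij]

end Charts

/-- Local count behind Euler's relation, where `s` tells which of the three edges at a vertex
descend. A vertex is lowest or highest on one of its facets in the mixed case, and on all three when
the signs agree. -/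
theorem sum_sign_count (s : Fin 3 → Bool) :
    (∑ i, if ∀ j, j ≠ i → s j = true then 1 else 0) +
      (∑ i, if ∀ j, j ≠ i → s j = false then 1 else 0) =
    1 + 2 * (if ∀ j, s j = true then 1 else 0) + 2 * (if ∀ j, s j = false then 1 else 0) := by
  revert s
  decide

theorem ncard_prod_eq_sum {α β : Type*} [Fintype α] [Fintype β] (p : α → β → Prop)
    [∀ a b, Decidable (p a b)] :
    {q : α × β | p q.1 q.2}.ncard = ∑ a, ∑ b, if p a b then 1 else 0 := by
  rw [← Fintype.sum_prod_type (fun q : α × β => if p q.1 q.2 then 1 else 0),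
    ← Finset.card_filter, ← Set.ncard_coe_finset]
  congr 1
  ext q
  simp

theorem ncard_eq_sum {α : Type*} [Fintype α] (p : α → Prop) [∀ a, Decidable (p a)] :
    {a | p a}.ncard = ∑ a, if p a then 1 else 0 := by
  rw [← Finset.card_filter, ← Set.ncard_coe_finset]
  congr 1
  ext q
  simp

/-! ### Linear functionals, connectivity of the graph, and Euler's relation -/

namespace IsVertexChart

variable {P : Set Space} {col : Facet P → Fin 3} {l : Facet P → StrongDual ℝ Space}
  {c : Facet P → ℝ} {fac : Vert P → Fin 3 → Facet P} {e : Vert P → Fin 3 → Space}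

theorem sub_nonneg (h : IsVertexChart P col l c fac e) (F : Facet P) {x : Space} (hx : x ∈ P) :
    0 ≤ c F - l F x :=
  _root_.sub_nonneg.2 (h.isFacetSystem.le F x hx)

theorem apply_sub_eq (h : IsVertexChart P col l c fac e) (φ : Module.Dual ℝ Space) (v : Vert P)
    (x : Space) : φ x - φ v = ∑ i, (c (fac v i) - l (fac v i) x) * φ (e v i) := by
  rw [← map_sub, h.sub_eq v x, map_sum]
  simp

theorem mem_fac (h : IsVertexChart P col l c fac e) (v : Vert P) (i : Fin 3) :
    (v : Space) ∈ (fac v i).1 := by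
  rw [h.mem_iff, h.col_fac]

/-- `P` lies in the cone at `v` generated by the edge directions, and on the facet of colour `i` the
`i`-th coefficient vanishes. -/
theorem apply_le_of_facet (h : IsVertexChart P col l c fac e) (φ : Module.Dual ℝ Space)
    (v : Vert P) {i : Fin 3} (hφ : ∀ j, j ≠ i → φ (e v j) ≤ 0) {x : Space}
    (hx : x ∈ (fac v i).1) : φ x ≤ φ v := by
  rw [← sub_nonpos, h.apply_sub_eq]
  refine Finset.sum_nonpos fun j _ => ?_
  obtain ⟨hxP, hxi⟩ := (h.isFacetSystem.mem_facet_iff _ _).1 hx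
  rcases eq_or_ne j i with rfl | hj
  · rw [hxi, sub_self, zero_mul]
  · exact mul_nonpos_of_nonneg_of_nonpos (h.sub_nonneg _ hxP) (hφ j hj)

theorem apply_le (h : IsVertexChart P col l c fac e) (φ : Module.Dual ℝ Space) (v : Vert P)
    (hφ : ∀ j, φ (e v j) ≤ 0) {x : Space} (hx : x ∈ P) : φ x ≤ φ v := by
  rw [← sub_nonpos, h.apply_sub_eq]
  exact Finset.sum_nonpos fun j _ =>
    mul_nonpos_of_nonneg_of_nonpos (h.sub_nonneg _ hx) (hφ j)

theorem eq_of_apply_le (h : IsVertexChart P col l c fac e) (φ : Module.Dual ℝ Space) (v : Vert P)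
    {x : Space} (hx : x ∈ P) (hφ : ∀ j, x ∈ (fac v j).1 ∨ φ (e v j) < 0) (hle : φ v ≤ φ x) :
    x = v := by
  have hterm : ∀ j ∈ Finset.univ, (c (fac v j) - l (fac v j) x) * φ (e v j) ≤ 0 := by
    intro j _
    rcases hφ j with hj | hj
    · rw [((h.isFacetSystem.mem_facet_iff _ _).1 hj).2, sub_self, zero_mul]
    · exact mul_nonpos_of_nonneg_of_nonpos (h.sub_nonneg _ hx) hj.le
  have hsum : ∑ j, (c (fac v j) - l (fac v j) x) * φ (e v j) = 0 :=
    le_antisymm (Finset.sum_nonpos hterm) (by rw [← h.apply_sub_eq]; exact _root_.sub_nonneg.2 hle)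
  rw [← sub_eq_zero, h.sub_eq v x]
  refine Finset.sum_eq_zero fun j hj => ?_
  have h0 := (Finset.sum_eq_zero_iff_of_nonpos hterm).1 hsum j hj
  rcases hφ j with hj | hj
  · rw [((h.isFacetSystem.mem_facet_iff _ _).1 hj).2, sub_self, zero_smul]
  · rw [(mul_eq_zero.1 h0).resolve_right hj.ne, zero_smul]

theorem exists_pos_mem_facet (h : IsVertexChart P col l c fac e) (v : Vert P) (i : Fin 3) :
    ∃ ε : ℝ, 0 < ε ∧ (v : Space) + ε • e v i ∈ P ∧
      ∀ j, j ≠ i → (v : Space) + ε • e v i ∈ (fac v j).1 := by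
  obtain ⟨ε, hε, hmem⟩ := h.exists_pos v i
  refine ⟨ε, hε, hmem, fun j hj => (h.isFacetSystem.mem_facet_iff _ _).2 ⟨hmem, ?_⟩⟩
  rw [map_add, map_smul, h.apply_of_ne v i j hj, smul_zero, add_zero]
  exact ((h.isFacetSystem.mem_facet_iff _ _).1 (h.mem_fac v j)).2

/-- The second vertex of the edge at `v` which leaves the facet of colour `i`. -/
theorem exists_neighbour (h : IsVertexChart P col l c fac e) (hP : IsPolytope P) (v : Vert P)
    (i : Fin 3) : ∃ w : Vert P, (∃ t : ℝ, 0 < t ∧ (w : Space) = v + t • e v i) ∧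
      ∀ j, j ≠ i → fac w j = fac v j := by
  obtain ⟨ε, hε, hεP, hεF⟩ := h.exists_pos_mem_facet v i
  -- The sum of the supporting functionals of the other two facets exposes their intersection, which
  -- is therefore the hull of its vertices. Containing `v + ε • e v i`, it has a vertex besides `v`.
  have hle : ∀ x ∈ P, (∑ j ∈ {i}ᶜ, l (fac v j)) x ≤ ∑ j ∈ {i}ᶜ, c (fac v j) := by
    intro x hx
    rw [_root_.sum_apply]
    exact Finset.sum_le_sum fun j _ => h.isFacetSystem.le _ x hx
  have hface := isFace_sep _ hle
  have hG : ∀ x, x ∈ {x ∈ P | (∑ j ∈ {i}ᶜ, l (fac v j)) x = ∑ j ∈ {i}ᶜ, c (fac v j)} ↔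
      x ∈ P ∧ ∀ j, j ≠ i → x ∈ (fac v j).1 := by
    intro x
    refine and_congr_right fun hx => ?_
    rw [_root_.sum_apply,
      Finset.sum_eq_sum_iff_of_le fun j _ => h.isFacetSystem.le _ x hx]
    simp [h.isFacetSystem.mem_facet_iff, hx]
  have heq := hP.face_eq_convexHull hface
  obtain ⟨w, hw, hwv⟩ : ∃ w ∈ Set.extremePoints ℝ P ∩
      {x ∈ P | (∑ j ∈ {i}ᶜ, l (fac v j)) x = ∑ j ∈ {i}ᶜ, c (fac v j)}, w ≠ v := by
    by_contra! hcon
    have h1 := (hG _).2 ⟨hεP, hεF⟩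
    rw [heq] at h1
    have h2 := convexHull_mono (𝕜 := ℝ) (t := {(v : Space)}) hcon h1
    rw [convexHull_singleton, Set.mem_singleton_iff, add_eq_left, smul_eq_zero] at h2
    exact h2.elim hε.ne' (h.ne_zero v i)
  have hwF := ((hG w).1 hw.2).2
  have hsub : w - v = (c (fac v i) - l (fac v i) w) • e v i := by
    rw [h.sub_eq v w]
    refine Finset.sum_eq_single i (fun j _ hj => ?_) (by simp)
    rw [((h.isFacetSystem.mem_facet_iff _ _).1 (hwF j hj)).2, sub_self, zero_smul]
  refine ⟨⟨w, hw.1⟩, ⟨c (fac v i) - l (fac v i) w, ?_, ?_⟩, fun j hj => ?_⟩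
  · refine lt_of_le_of_ne (h.sub_nonneg _ hw.1.1) fun h0 => ?_
    rw [← h0, zero_smul, sub_eq_zero] at hsub
    exact hwv hsub
  · rw [← hsub]
    simp
  · have := (h.mem_iff ⟨w, hw.1⟩ _).1 (hwF j hj)
    rwa [h.col_fac] at this

/-- The graph of a simple 3-polytope is connected. -/
theorem eq_of_forall_neighbour (h : IsVertexChart P col l c fac e)
    (hP : IsPolytope P) {α : Type*} (g : Vert P → α)
    (hg : ∀ v w i, (∀ j, j ≠ i → fac w j = fac v j) → g w = g v) (v w : Vert P) : g v = g w := by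
  have hfin : Finite (Vert P) := hP.finite_extremePoints.to_subtype
  by_contra hne
  -- On `P` this functional is maximal only at `w`. From a highest vertex `u` with `g u ≠ g w`, some
  -- edge therefore ascends, to a vertex with the same value of `g`: a contradiction.
  let φ : Module.Dual ℝ Space := ∑ i, (l (fac w i) : Space →ₗ[ℝ] ℝ)
  have hφ : ∀ x, φ x = ∑ i, l (fac w i) x := fun x => by simp [φ]
  obtain ⟨u, hu, hmax⟩ := Set.exists_max_image {u | g u ≠ g w} (fun u => φ u) (Set.toFinite _)
    ⟨v, hne⟩
  have hu' : u ≠ w := fun h0 => hu (by rw [h0])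
  obtain ⟨i, hi⟩ : ∃ i, 0 < φ (e u i) := by
    by_contra! hcon
    have h1 := h.apply_le φ u hcon w.2.1
    apply hu'
    apply Subtype.ext
    have hle : ∀ i ∈ Finset.univ, l (fac w i) u ≤ c (fac w i) :=
      fun i _ => h.isFacetSystem.le _ u u.2.1
    have hw : ∀ i, l (fac w i) w = c (fac w i) := fun i =>
      ((h.isFacetSystem.mem_facet_iff _ _).1 (h.mem_fac w i)).2
    rw [hφ, hφ] at h1
    simp only [hw] at h1
    have h2 := (Finset.sum_eq_sum_iff_of_le hle).1 (le_antisymm (Finset.sum_le_sum hle) h1)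
    rw [← sub_eq_zero, h.sub_eq w u]
    exact Finset.sum_eq_zero fun i hi => by rw [h2 i hi, sub_self, zero_smul]
  obtain ⟨u', ⟨t, ht, hu't⟩, hfac⟩ := h.exists_neighbour hP u i
  have hgu := hg u u' i hfac
  have := hmax u' (by rw [Set.mem_ofPred_eq, hgu]; exact hu)
  rw [hu't, map_add, map_smul, smul_eq_mul] at this
  have := mul_pos ht hi
  linarith

theorem exists_vertex (h : IsVertexChart P col l c fac e) (hP : IsPolytope P)
    (φ : Module.Dual ℝ Space) (F : Facet P) :
    ∃ v : Vert P, fac v (col F) = F ∧ ∀ x ∈ F.1, φ x ≤ φ v := by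
  have heq := hP.face_eq_convexHull F.2.1
  have hne := F.2.2.1
  rw [heq, convexHull_nonempty_iff] at hne
  obtain ⟨v, hv, hmax⟩ := Set.exists_max_image _ φ
    (hP.finite_extremePoints.subset (Set.inter_subset_left (t := F.1))) hne
  refine ⟨⟨v, hv.1⟩, (h.mem_iff _ _).1 hv.2, fun x hx => ?_⟩
  rw [heq] at hx
  exact le_of_mem_convexHull φ hmax hx

/-- Every facet has exactly one vertex at which a functional in general position is maximal. -/
theorem card_facet_eq (h : IsVertexChart P col l c fac e) (hP : IsPolytope P)
    (φ : Module.Dual ℝ Space) (hφ : ∀ v i, φ (e v i) ≠ 0) :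
    Nat.card (Facet P) = {p : Vert P × Fin 3 | ∀ j, j ≠ p.2 → φ (e p.1 j) < 0}.ncard := by
  -- The pairs are the vertices that are local maxima on their facet of colour `i`; local maxima on
  -- a facet are global and unique.
  refine (Nat.card_eq_of_bijective (fun p : {p : Vert P × Fin 3 | ∀ j, j ≠ p.2 → φ (e p.1 j) < 0} =>
    fac p.1.1 p.1.2) ⟨?_, fun F => ?_⟩).symm
  · rintro ⟨⟨v, i⟩, hv⟩ ⟨⟨w, j⟩, hw⟩ hvw
    have hvw : fac v i = fac w j := hvw
    obtain rfl : i = j := by rw [← h.col_fac v i, hvw, h.col_fac]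
    have hwv : (w : Space) ∈ (fac v i).1 := hvw ▸ h.mem_fac w i
    have hvw' : (v : Space) ∈ (fac w i).1 := hvw ▸ h.mem_fac v i
    have hle := h.apply_le_of_facet φ w (fun j hj => (hw j hj).le) hvw'
    have : (w : Space) = v := by
      refine h.eq_of_apply_le φ v w.2.1 (fun j => ?_) hle
      rcases eq_or_ne j i with rfl | hj
      · exact Or.inl hwv
      · exact Or.inr (hv j hj)
    obtain rfl : w = v := Subtype.ext this
    rfl
  · obtain ⟨v, hv, hmax⟩ := h.exists_vertex hP φ F
    refine ⟨⟨(v, col F), fun j hj => ?_⟩, hv⟩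
    obtain ⟨ε, hε, -, hεF⟩ := h.exists_pos_mem_facet v j
    have h1 := hεF (col F) (Ne.symm hj)
    rw [hv] at h1
    have h2 := hmax _ h1
    rw [map_add, map_smul, smul_eq_mul] at h2
    refine lt_of_le_of_ne ?_ (hφ v j)
    by_contra! hcon
    have := mul_pos hε hcon
    linarith

/-- By convexity a vertex from which all edges descend is the unique maximum on `P`. -/
theorem ncard_maximal (h : IsVertexChart P col l c fac e) (hP : IsPolytope P)
    (hne : (Vert P).Nonempty) (φ : Module.Dual ℝ Space) (hφ : ∀ v i, φ (e v i) ≠ 0) :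
    {v : Vert P | ∀ j, φ (e v j) < 0}.ncard = 1 := by
  obtain ⟨v, hv, hmax⟩ := Set.exists_max_image _ φ hP.finite_extremePoints hne
  rw [Set.ncard_eq_one]
  refine ⟨⟨v, hv⟩, Set.eq_singleton_iff_unique_mem.2 ⟨fun j => ?_, fun w hw => ?_⟩⟩
  · obtain ⟨ε, hε, hεP⟩ := h.exists_pos ⟨v, hv⟩ j
    have h2 := le_of_mem_convexHull φ hmax (hP.eq_convexHull_extremePoints.subset hεP)
    rw [map_add, map_smul, smul_eq_mul] at h2
    refine lt_of_le_of_ne ?_ (hφ _ j)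
    by_contra! hcon
    have := mul_pos hε hcon
    linarith
  · exact Subtype.ext (h.eq_of_apply_le φ w hv.1 (fun j => Or.inr (hw j)) (hmax w w.2)).symm

/-- Euler's relation for simple 3-polytopes. -/
theorem two_mul_card_facet (h : IsVertexChart P col l c fac e) (hP : IsPolytope P)
    (hne : (Vert P).Nonempty) : 2 * Nat.card (Facet P) = Nat.card (Vert P) + 4 := by
  classical
  have hfin : Finite (Vert P) := hP.finite_extremePoints.to_subtype
  have : Fintype (Vert P) := Fintype.ofFinite _
  obtain ⟨φ, hφ'⟩ := Module.exists_dual_forall_apply_ne_zero (K := ℝ)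
    (fun p : Vert P × Fin 3 => e p.1 p.2) fun p => h.ne_zero p.1 p.2
  have hφ : ∀ v i, φ (e v i) ≠ 0 := fun v i => hφ' (v, i)
  have hφn : ∀ v i, (-φ) (e v i) ≠ 0 := fun v i => neg_ne_zero.2 (hφ v i)
  let s : Vert P → Fin 3 → Bool := fun v i => decide (φ (e v i) < 0)
  have hs : ∀ v i, φ (e v i) < 0 ↔ s v i = true := fun v i => by simp [s]
  have hs' : ∀ v i, (-φ) (e v i) < 0 ↔ s v i = false := fun v i => by
    simp only [s, LinearMap.neg_apply, neg_lt_zero, decide_eq_false_iff_not, not_lt]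
    exact ⟨le_of_lt, fun h0 => lt_of_le_of_ne h0 (hφ v i).symm⟩
  have h1 := h.card_facet_eq hP φ hφ
  have h2 := h.card_facet_eq hP (-φ) hφn
  have h3 := h.ncard_maximal hP hne φ hφ
  have h4 := h.ncard_maximal hP hne (-φ) hφn
  simp only [hs] at h1 h3
  simp only [hs'] at h2 h4
  rw [ncard_prod_eq_sum (fun v i => ∀ j, j ≠ i → s v j = true)] at h1
  rw [ncard_prod_eq_sum (fun v i => ∀ j, j ≠ i → s v j = false)] at h2
  rw [ncard_eq_sum] at h3 h4
  -- Summing the local count over the vertices counts one maximum and one minimum per facet on the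
  -- left, and `|V| + 2 + 2` on the right.
  have key := Finset.sum_congr (rfl : (Finset.univ : Finset (Vert P)) = Finset.univ)
    fun v _ => sum_sign_count (s v)
  simp only [Finset.sum_add_distrib, ← Finset.mul_sum] at key
  rw [← h1, ← h2, h3, h4, ← Finset.card_eq_sum_ones, Finset.card_univ,
    ← Nat.card_eq_fintype_card] at key
  omega

end IsVertexChart

/-! ### Affine dependences of the incidence vectors -/

section IncidenceVectors

variable {P : Set Space} {col : Facet P → Fin 3} {l : Facet P → StrongDual ℝ Space}
  {c : Facet P → ℝ} {fac : Vert P → Fin 3 → Facet P} {e : Vert P → Fin 3 → Space}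

theorem IsVertexChart.sum_smul_incidence [Fintype (Facet P)]
    (h : IsVertexChart P col l c fac e) (b : Facet P → ℝ) (v : Vert P) :
    (∑ F : Facet P, b F • incidence P F.1) v = ∑ i, b (fac v i) := by
  classical
  have h1 : ∀ F : Facet P, (b F • incidence P F.1) v =
      if fac v (col F) = F then b F else 0 := by
    intro F
    have hF := h.mem_iff v F
    by_cases h0 : fac v (col F) = F
    · simp [incidence, h0, hF.2 h0]
    · simp [incidence, h0, mt hF.1 h0]
  rw [Finset.sum_apply]
  simp only [h1]
  rw [← Finset.sum_filter]
  refine Finset.sum_nbij' col (fac v) ?_ ?_ ?_ ?_ ?_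
  · simp
  · intro i _
    simp [h.col_fac]
  · intro F hF
    exact (Finset.mem_filter.1 hF).2
  · intro i _
    exact h.col_fac v i
  · intro F hF
    rw [(Finset.mem_filter.1 hF).2]

theorem sum_colour [Fintype (Facet P)] (β : Fin 3 → ℝ) :
    ∑ F, β (col F) = ∑ i, colourCount P col i * β i := by
  classical
  rw [← Finset.sum_fiberwise' Finset.univ col β]
  refine Finset.sum_congr rfl fun i _ => ?_
  rw [Finset.sum_const, nsmul_eq_mul, colourCount, ← Set.ncard_coe_finset]
  simp

theorem card_facet_eq_sum [Finite (Facet P)] :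
    Nat.card (Facet P) = ∑ i, colourCount P col i := by
  have : Fintype (Facet P) := Fintype.ofFinite _
  have := sum_colour (col := col) fun _ => 1
  simp only [Finset.sum_const, nsmul_eq_mul, mul_one, Finset.card_univ] at this
  rw [Nat.card_eq_fintype_card]
  exact_mod_cast this

/-- The coefficients, by colour, of the affine dependence between the incidence vectors. -/
noncomputable def colourCoeff (P : Set Space) (col : Facet P → Fin 3) : Fin 3 → ℝ :=
  ![colourCount P col 1 - colourCount P col 2, colourCount P col 2 - colourCount P col 0,
    colourCount P col 0 - colourCount P col 1]

/-- The coefficients are the cross product of `(m₁, m₂, m₃)` and `(1, 1, 1)`; distinctness of the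
`mᵢ` makes them all nonzero. -/
theorem IsVertexChart.isAffineCircuit [Fintype (Facet P)]
    (h : IsVertexChart P col l c fac e) (hP : IsPolytope P) (hne : (Vert P).Nonempty)
    (h01 : colourCount P col 0 ≠ colourCount P col 1)
    (h12 : colourCount P col 1 ≠ colourCount P col 2)
    (h02 : colourCount P col 0 ≠ colourCount P col 2) :
    IsAffineCircuit (fun F : Facet P => incidence P F.1) (fun F => colourCoeff P col (col F)) where
  sum_eq_zero := by
    rw [sum_colour, Fin.sum_univ_three]
    simp only [colourCoeff, Matrix.cons_val]
    ring
  sum_smul_eq_zero := by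
    ext v
    rw [h.sum_smul_incidence]
    simp only [h.col_fac, Fin.sum_univ_three, colourCoeff, Matrix.cons_val]
    simp
  exists_smul b hb hb' := by
    obtain ⟨v₀, hv₀⟩ := hne
    have hsum : ∀ v, ∑ i, b (fac v i) = 0 := fun v => by
      rw [← h.sum_smul_incidence, hb', Pi.zero_apply]
    -- Along an edge two facets are kept, and since the three coefficients at each end sum to zero,
    -- the third coefficient is kept too.
    have hconst : ∀ v w i, b (fac v i) = b (fac w i) := by
      intro v w j
      refine h.eq_of_forall_neighbour hP (fun v => b (fac v j)) (fun v w i hvw => ?_) v w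
      rcases eq_or_ne j i with rfl | hj
      · have h1 := hsum v
        have h2 := hsum w
        rw [← Finset.add_sum_erase _ _ (Finset.mem_univ j)] at h1 h2
        have h3 : ∑ i ∈ Finset.univ.erase j, b (fac w i) =
            ∑ i ∈ Finset.univ.erase j, b (fac v i) :=
          Finset.sum_congr rfl fun i hi => by rw [hvw i (Finset.ne_of_mem_erase hi)]
        linarith
      · rw [hvw j hj]
    obtain ⟨β, hbβ, hβ⟩ : ∃ β : Fin 3 → ℝ, (∀ F, b F = β (col F)) ∧ ∑ i, β i = 0 := by
      refine ⟨fun i => b (fac ⟨v₀, hv₀⟩ i), fun F => ?_, hsum _⟩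
      obtain ⟨v, hv, -⟩ := h.exists_vertex hP 0 F
      exact (congrArg b hv).symm.trans (hconst v _ _)
    simp only [hbβ] at hb ⊢
    rw [sum_colour, Fin.sum_univ_three] at hb
    rw [Fin.sum_univ_three] at hβ
    have h02' : (colourCount P col 2 : ℝ) - colourCount P col 0 ≠ 0 :=
      sub_ne_zero.2 (by exact_mod_cast h02.symm)
    -- The factor is read off at the second colour; the two linear equations determine the other two
    -- values.
    refine ⟨β 1 / (colourCount P col 2 - colourCount P col 0), fun F => ?_⟩
    generalize col F = i
    rw [div_mul_eq_mul_div, eq_div_iff h02']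
    fin_cases i
    · simp only [colourCoeff, Fin.zero_eta, Matrix.cons_val]
      linear_combination (colourCount P col 2 : ℝ) * hβ - hb
    · simp [colourCoeff]
    · simp only [colourCoeff, Fin.reduceFinMk, Matrix.cons_val]
      linear_combination hb - (colourCount P col 0 : ℝ) * hβ
  ne_zero F := by
    have h01' : (colourCount P col 0 : ℝ) ≠ colourCount P col 1 := by exact_mod_cast h01
    have h12' : (colourCount P col 1 : ℝ) ≠ colourCount P col 2 := by exact_mod_cast h12
    have h02' : (colourCount P col 0 : ℝ) ≠ colourCount P col 2 := by exact_mod_cast h02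
    generalize col F = i
    fin_cases i
    · simpa [colourCoeff] using sub_ne_zero.2 h12'
    · simpa [colourCoeff] using sub_ne_zero.2 h02'.symm
    · simpa [colourCoeff] using sub_ne_zero.2 h01'

theorem colourCoeff_pos_iff (h01 : colourCount P col 0 < colourCount P col 1)
    (h12 : colourCount P col 1 < colourCount P col 2) (i : Fin 3) :
    0 < colourCoeff P col i ↔ i = 1 := by
  have h01' : (colourCount P col 0 : ℝ) < colourCount P col 1 := by exact_mod_cast h01
  have h12' : (colourCount P col 1 : ℝ) < colourCount P col 2 := by exact_mod_cast h12
  fin_cases i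
  · simpa [colourCoeff] using h12'.le
  · simpa [colourCoeff] using h01'.trans h12'
  · simpa [colourCoeff] using h01'.le

theorem colourCoeff_neg_iff (h01 : colourCount P col 0 < colourCount P col 1)
    (h12 : colourCount P col 1 < colourCount P col 2) (i : Fin 3) :
    colourCoeff P col i < 0 ↔ i = 0 ∨ i = 2 := by
  have h01' : (colourCount P col 0 : ℝ) < colourCount P col 1 := by exact_mod_cast h01
  have h12' : (colourCount P col 1 : ℝ) < colourCount P col 2 := by exact_mod_cast h12
  fin_cases i
  · simpa [colourCoeff] using h12'
  · simpa [colourCoeff] using (h01'.trans h12').le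
  · simpa [colourCoeff] using h01'

theorem exists_ne_of_one_lt_ncard {α : Type*} {p : α → Prop} (h : 1 < {a | p a}.ncard) (b : α) :
    ∃ a, a ≠ b ∧ p a := by
  obtain ⟨a, ha, hab⟩ := Set.exists_ne_of_one_lt_ncard h b
  exact ⟨a, hab, ha⟩

theorem ncard_setOf_equiv {α β : Type*} (f : α ≃ β) (p : β → Prop) :
    {a | p (f a)}.ncard = {b | p b}.ncard :=
  Nat.card_congr (f.subtypeEquiv fun _ => Iff.rfl)

end IncidenceVectors

end HullOfFaces

/-! ### The theorem -/

theorem proposition1 (P : Set Space) (hP : IsSimple3Polytope P)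
    (col : Facet P → Fin 3) (hcol : IsFaceColouring P col)
    (n : ℕ) (hn : (Vert P).ncard = 2 * n)
    (m₁ m₂ m₃ : ℕ) (hm₁ : colourCount P col 0 = m₁) (hm₂ : colourCount P col 1 = m₂)
    (hm₃ : colourCount P col 2 = m₃)
    (h₁ : 2 ≤ m₁) (h₁₂ : m₁ < m₂) (h₂₃ : m₂ < m₃)
    (V₁ V₂ V₃ : Set (Vert P → ℝ)) (hV₁ : V₁ = colourClass P col 0)
    (hV₂ : V₂ = colourClass P col 1) (hV₃ : V₃ = colourClass P col 2) :
    -- the Gale diagram, unique up to the reflection of the line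
    (∃ D : (Set.extremePoints ℝ (incidenceHull P)) → EuclideanSpace ℝ (Fin 1),
      IsGaleDiagram (incidenceHull P) D ∧
      (∀ D' : (Set.extremePoints ℝ (incidenceHull P)) → EuclideanSpace ℝ (Fin 1),
        IsGaleDiagram (incidenceHull P) D' → D' = D ∨ D' = -D) ∧
      (∀ x : Set.extremePoints ℝ (incidenceHull P), (x : Vert P → ℝ) ∈ V₂ → D x = !₂[(1 : ℝ)]) ∧
      (∀ x : Set.extremePoints ℝ (incidenceHull P), (x : Vert P → ℝ) ∈ V₁ ∪ V₃ → D x = !₂[(-1 : ℝ)]) ∧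
      {x | D x = !₂[(1 : ℝ)]}.ncard = m₂ ∧
      {x | D x = !₂[(-1 : ℝ)]}.ncard = m₁ + m₃) ∧
    -- the proper faces
    (∀ W : Set (Vert P → ℝ), W ⊆ Set.extremePoints ℝ (incidenceHull P) →
      (IsProperFace (incidenceHull P) (convexHull ℝ W) ↔ ¬ V₂ ⊆ W ∧ ¬ V₁ ∪ V₃ ⊆ W)) ∧
    -- simpliciality
    IsSimplicialPolytope (incidenceHull P) ∧
    -- the combinatorial type
    (∃ T : Set (EuclideanSpace ℝ (Fin n)), IsT n (m₂ - 1) T) ∧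
    (∀ T : Set (EuclideanSpace ℝ (Fin n)), IsT n (m₂ - 1) T → CombEquiv (incidenceHull P) T) := by
  have hfinF := hP.finite_facet
  have hfinV := hP.finite_vert
  have : Fintype (Facet P) := Fintype.ofFinite _
  obtain ⟨l, c, fac, e, h⟩ := exists_isVertexChart hP hcol
  have h01 : colourCount P col 0 < colourCount P col 1 := by omega
  have h12 : colourCount P col 1 < colourCount P col 2 := by omega
  have hne : (Vert P).Nonempty := by
    by_contra hcon
    rw [Set.not_nonempty_iff_eq_empty] at hcon
    have h0 := hP.1.eq_convexHull_extremePoints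
    rw [show Set.extremePoints ℝ P = ∅ from hcon, convexHull_empty] at h0
    have := hP.2.1
    rw [h0, affDim, vectorSpan_empty, finrank_bot] at this
    omega
  have hv := h.isAffineCircuit hP.1 hne h01.ne h12.ne (h01.trans h12).ne
  have hpos := fun F : Facet P => colourCoeff_pos_iff h01 h12 (col F)
  have hneg := fun F : Facet P => colourCoeff_neg_iff h01 h12 (col F)
  have hcard : Nat.card (Facet P) = m₁ + m₂ + m₃ := by
    rw [card_facet_eq_sum (col := col), Fin.sum_univ_three, hm₁, hm₂, hm₃]
  have hEuler : 2 * Nat.card (Facet P) = 2 * n + 4 := by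
    rw [h.two_mul_card_facet hP.1 hne, ← hn]
    rfl
  have hposcard : {F : Facet P | 0 < colourCoeff P col (col F)}.ncard = m₂ := by
    simp only [hpos]
    exact hm₂
  have hnegcard : {F : Facet P | colourCoeff P col (col F) < 0}.ncard = m₁ + m₃ := by
    have h1 := Set.ncard_add_ncard_compl {F : Facet P | 0 < colourCoeff P col (col F)}
    have h2 : {F : Facet P | 0 < colourCoeff P col (col F)}ᶜ =
        {F : Facet P | colourCoeff P col (col F) < 0} := by
      ext F
      have := hv.ne_zero F
      simp only [Set.mem_compl_iff, Set.mem_ofPred_eq, not_lt]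
      exact ⟨fun h0 => lt_of_le_of_ne h0 this, le_of_lt⟩
    rw [h2, hposcard, hcard] at h1
    omega
  -- Both signs occur at least twice, so the incidence vectors are distinct and all are vertices of
  -- the hull.
  have hp := exists_ne_of_one_lt_ncard (p := fun F : Facet P => 0 < colourCoeff P col (col F))
    (by omega)
  have hn' := exists_ne_of_one_lt_ncard (p := fun F : Facet P => colourCoeff P col (col F) < 0)
    (by omega)
  have hinj := hv.injective hp hn'
  have hext := hv.extremePoints_eq hp hn'
  have hK : incidenceHull P = convexHull ℝ (Set.range fun F : Facet P => incidence P F.1) := rfl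
  have hV₂' : ∀ F : Facet P, incidence P F.1 ∈ V₂ ↔ 0 < colourCoeff P col (col F) := by
    intro F
    rw [hV₂, hpos]
    constructor
    · rintro ⟨G, hG, hFG⟩
      rwa [hinj hFG]
    · exact fun hF => ⟨F, hF, rfl⟩
  have hV₁₃' : ∀ F : Facet P, incidence P F.1 ∈ V₁ ∪ V₃ ↔ colourCoeff P col (col F) < 0 := by
    intro F
    rw [hV₁, hV₃, hneg]
    constructor
    · rintro (⟨G, hG, hFG⟩ | ⟨G, hG, hFG⟩)
      · exact Or.inl (by rwa [hinj hFG])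
      · exact Or.inr (by rwa [hinj hFG])
    · rintro (hF | hF)
      · exact Or.inl ⟨F, hF, rfl⟩
      · exact Or.inr ⟨F, hF, rfl⟩
  have hV₂r : V₂ ⊆ Set.range fun F : Facet P => incidence P F.1 := by
    rw [hV₂]
    rintro x ⟨F, -, rfl⟩
    exact ⟨F, rfl⟩
  have hV₁₃r : V₁ ∪ V₃ ⊆ Set.range fun F : Facet P => incidence P F.1 := by
    rw [hV₁, hV₃]
    rintro x (⟨F, -, rfl⟩ | ⟨F, -, rfl⟩) <;> exact ⟨F, rfl⟩
  refine ⟨?_, ?_, hv.isSimplicialPolytope, exists_isT (by omega) (by omega), ?_⟩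
  · let f : Set.extremePoints ℝ (incidenceHull P) ≃ Facet P :=
      (Equiv.setCongr hext).trans (Equiv.ofInjective _ hinj).symm
    have hf : ∀ x, incidence P (f x).1 = x := fun x =>
      Equiv.apply_ofInjective_symm hinj (Equiv.setCongr hext x)
    have : Fintype (Set.extremePoints ℝ (incidenceHull P)) := Fintype.ofEquiv _ f.symm
    have : Nonempty (Set.extremePoints ℝ (incidenceHull P)) := by
      have : Nonempty (Facet P) := (Nat.card_pos_iff.1 (by omega)).1
      exact f.nonempty
    have hvf := hv.comp_equiv f
    rw [show (fun F : Facet P => incidence P F.1) ∘ f = fun x => x.1 from funext hf] at hvf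
    obtain ⟨D, hD, hD', hD1, hD2⟩ := hvf.exists_isGaleDiagram
    refine ⟨D, hD, hD', fun x hx => ?_, fun x hx => ?_, ?_, ?_⟩
    · rw [hD1]
      rw [← hf x, hV₂'] at hx
      exact hx
    · rw [hD2]
      rw [← hf x, hV₁₃'] at hx
      exact hx
    · simp only [hD1]
      rw [← hposcard]
      exact ncard_setOf_equiv f fun F => 0 < colourCoeff P col (col F)
    · simp only [hD2]
      rw [← hnegcard]
      exact ncard_setOf_equiv f fun F => colourCoeff P col (col F) < 0
  · intro W hW
    rw [hK, hext] at hW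
    obtain ⟨S, rfl⟩ := Set.subset_range_iff_exists_image_eq.1 hW
    rw [hK, hv.isProperFace_convexHull_image_iff hp hn']
    have key : ∀ V : Set (Vert P → ℝ), V ⊆ (Set.range fun F : Facet P => incidence P F.1) →
        (¬ V ⊆ (fun F : Facet P => incidence P F.1) '' S ↔ ∃ F, F ∉ S ∧ incidence P F.1 ∈ V) := by
      intro V hV
      rw [Set.not_subset]
      constructor
      · rintro ⟨x, hx, hxS⟩
        obtain ⟨F, rfl⟩ := hV hx
        exact ⟨F, fun hF => hxS ⟨F, hF, rfl⟩, hx⟩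
      · rintro ⟨F, hF, hFV⟩
        exact ⟨_, hFV, fun hFS => hF ((hinj.mem_set_image).1 hFS)⟩
    rw [key V₂ hV₂r, key (V₁ ∪ V₃) hV₁₃r]
    simp only [hV₂', hV₁₃']
  · intro T hT
    obtain ⟨v', a', hv', rfl, ha'⟩ := hT.exists_isAffineCircuit (by omega)
    -- Both circuits have `n + 2` members, of which `m₂ = (m₂ - 1) + 1` are positive.
    obtain ⟨f, hf⟩ := exists_equiv_of_ncard_eq
      (p := fun F : Facet P => 0 < colourCoeff P col (col F)) (q := fun i => 0 < a' i)
      (by rw [Nat.card_eq_fintype_card (α := Option _), Fintype.card_option, Fintype.card_fin]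
          omega)
      (by rw [hposcard, ha']; omega)
    obtain ⟨F⟩ : Nonempty (Facet P) := (Nat.card_pos_iff.1 (by omega)).1
    exact hv.combEquiv hv' f hf ((hp F).imp fun _ h0 => h0.2) ((hn' F).imp fun _ h0 => h0.2)
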